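/- Let $\mathcal X$ be a measurable space, $\mathcal Y=\{-1,+1\}$, $\mathcal Z=\mathcal X\times\mathcal Y$, let $F\subseteq\mathcal Y^{\mathcal X}$ be a nonempty class of measurable functions, and let $\ell((x,y),f)=\mathbf 1\{y\ne f(x)\}$ be the $0$-$1$ loss. Write $\ell(P,f)=\mathbb E_{z\sim P}\,\ell(z,f)$ for a probability measure $P$ on $\mathcal Z$. A sequence $\hat f_{0:n-1}$ of learning rules assigns to each history $z_{1:t}\in\mathcal Z^t$, $0\le t<n$, a (possibly random) function $\hat f_t=\hat f_t(z_{1:t})\in F$. * $F$ is *online learnable* if $\limsup_{n\to\infty}\mathcal V^{\rm online}_n(F)=0$, where $$\mathcal V^{\rm online}_n(F)=\inf_{\hat f_{0:n-1}}\ \sup_{z_{1:n}\in\mathcal Z^n}\ \mathbb E\Big[\tfrac1n\Big(\sum_{t=1}^n\ell(z_t,\hat f_{t-1})-\inf_{f\in F}\sum_{t=1}^n\ell(z_t,f)\Big)\Big].$$ * $F$ satisfies the *uniform martingale law of large numbers* (UMLLN) if $$\limsup_{n\to\infty}\ \sup\ \mathbb E\Big[\sup_{f\in F}\Big|\tfrac1n\sum_{t=1}^n\big(f(X_t)-\mathbb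 E[f(X_t)\mid\mathcal A_{t-1}]\big)\Big|\Big]=0,$$ the outer supremum being over all probability spaces, filtrations $(\mathcal A_t)$ and $\mathcal X$-valued processes $X_{1:n}$ with $X_t$ $\mathcal A_t$-measurable. * A complete binary tree $\mathbf x$ of depth $n$ is a sequence of maps $\mathbf x_t:\{\pm1\}^{t-1}\to\mathcal X$, $1\le t\le n$. It is shattered by $F$ if for every $\epsilon_{1:n}\in\{\pm1\}^n$ there is $f\in F$ with $f(\mathbf x_t(\epsilon_{1:t-1}))=\epsilon_t$ for all $t$. The Littlestone dimension $\mathrm{Ldim}(F)\in\{0,1,\dots,\infty\}$ is the supremum of the depths of the trees shattered by $F$. * The sequential Rademacher complexity is $\mathfrak R_n(F)=\sup_{\mathbf x}\mathbb E\big[\sup_{f\in F}\frac1n\sum_{t=1}^n\epsilon_tf(\mathbf x_t(\epsilon_{1:t-1}))\big]$, with $\epsilon_{1:n}$ independent uniform signs and the supremum over all trees of depth $n$. * $F$ is *prequentially learnable* if $\limsup_{n\to\infty}\mathcal V^{\rm preq}_n(F)=0$, where $$\mathcal V^{\rm preq}_n(F)=\inf_{\hat f_{0:n-1}}\ \sup_{\mathbb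 P}\ \mathbb E\Big[\tfrac1n\sum_{t=1}^n\ell(P_t,\hat f_{t-1})-\inf_{f\in F}\tfrac1n\sum_{t=1}^n\ell(P_t,f)\Big].$$ Here $\mathbb P$ ranges over all joint laws of $Z_{1:n}\in\mathcal Z^n$ given by regular conditional laws $P_t=P_t(\cdot\,;Z_{1:t-1})$ of $Z_t$ given $Z_{1:t-1}$, the rule $\hat f_{t-1}$ is applied to $Z_{1:t-1}$, and the expectation is over $Z_{1:n}$ and the internal randomness of the rules. (Conventions for uncountable $F$ and non-measurable rules: in UMLLN and in $\mathcal V^{\rm preq}_n$ the supremum, respectively infimum, over $f\in F$ of random variables is the essential one; its expectation is the supremum, respectively infimum, over countable nonempty $G\subseteq F$ of the expectation of the pointwise supremum, respectively infimum, over $G$. In $\mathcal V^{\rm preq}_n$, where the rules are arbitrary maps of the history, the expectation is the successive upper expectation over $Z_n,\dots,Z_1$ under $P_n,\dots,P_1$, which is the ordinary expectation whenever the integrand is measurable.) **Theorem.** The following are equivalent: 1. $F$ is online learnable; 2. the UMLLN holds for $F$; 3. $\mathrm{Ldim}(F)<\infty$; 4. $\limsup_{n\to\infty}\mathfrak R_n(F)=0$;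 5. $F$ is prequentially learnable. -/

import Mathlib

open MeasureTheory ProbabilityTheory Filter

namespace Learn

noncomputable section

universe u

/-- The numerical value of a binary label: `true` stands for `+1` and `false` for `-1`. -/
def sgn (b : Bool) : ℝ := if b then 1 else -1

/-- The 0-1 loss of the function `f` on the input-output pair `z = (x, y)`. -/
def loss {X : Type u} (z : X × Bool) (f : X → Bool) : ℝ := if f z.1 ≠ z.2 then 1 else 0

/-- The initial segment of length `t` of a sequence of length `n`. -/
def past {α : Type*} {n : ℕ} (z : Fin n → α) (t : Fin n) : Fin t → α :=
  fun i => z (Fin.castLE t.isLt.le i)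

/-! ### Trees, Littlestone dimension, sequential Rademacher complexity -/

/-- A complete binary tree of depth `n` labelled by `X`: the label at level `t + 1` is a function
of the first `t` signs of a path. -/
abbrev Tree (X : Type u) (n : ℕ) : Type u := (t : Fin n) → (Fin t → Bool) → X

/-- The tree `x` is shattered by `F`. -/
def Shatters {X : Type u} (F : Set (X → Bool)) {n : ℕ} (x : Tree X n) : Prop :=
  ∀ ε : Fin n → Bool, ∃ f ∈ F, ∀ t : Fin n, f (x t (past ε t)) = ε t

/-- The Littlestone dimension, with value `⊤` if trees of arbitrarily large depth are shattered. -/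
def ldim {X : Type u} (F : Set (X → Bool)) : ℕ∞ :=
  ⨆ (n : ℕ) (_ : ∃ x : Tree X n, Shatters F x), (n : ℕ∞)

/-- Sequential Rademacher complexity of `F` on the tree `x`; the expectation over independent
uniform signs is the average over all `2 ^ n` sign sequences. -/
def seqRadTree {X : Type u} (F : Set (X → Bool)) {n : ℕ} (x : Tree X n) : ℝ :=
  (∑ ε : Fin n → Bool,
    ⨆ f : F, (1 / (n : ℝ)) * ∑ t : Fin n, sgn (ε t) * sgn (f.1 (x t (past ε t)))) / 2 ^ n

/-- Sequential Rademacher complexity of `F`: the worst case over all trees of depth `n`. -/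
def seqRad {X : Type u} (F : Set (X → Bool)) (n : ℕ) : ℝ :=
  ⨆ x : Tree X n, seqRadTree F x

/-! ### Online learnability -/

/-- A sequence of (proper, randomized) learning rules: after the history `z₁, …, z_t` the rule
outputs a random element of `F`, given by its law on `F` (for the σ-algebra generated by the
evaluations `f ↦ f x`). Only these laws enter the expected losses. -/
abbrev Rules {X : Type u} (F : Set (X → Bool)) : Type u :=
  (t : ℕ) → (Fin t → X × Bool) → ProbabilityMeasure F

/-- Expected loss on `z` of a random function with law `q`. -/
def randLoss {X : Type u} {F : Set (X → Bool)} (z : X × Bool) (q : ProbabilityMeasure F) : ℝ :=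
  ∫ f : F, loss z f.1 ∂(q : Measure F)

/-- Expected normalized regret of the rules on an individual sequence. -/
def onlineRegret {X : Type u} {F : Set (X → Bool)} (A : Rules F) {n : ℕ}
    (z : Fin n → X × Bool) : ℝ :=
  (1 / (n : ℝ)) * ((∑ t : Fin n, randLoss (z t) (A t (past z t))) -
    ⨅ f : F, ∑ t : Fin n, loss (z t) f.1)

/-- The minimax value of the online game with `n` rounds. -/
def onlineValue {X : Type u} (F : Set (X → Bool)) (n : ℕ) : ℝ :=
  ⨅ A : Rules F, ⨆ z : Fin n → X × Bool, onlineRegret A z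

def OnlineLearnable {X : Type u} (F : Set (X → Bool)) : Prop :=
  limsup (fun n : ℕ => onlineValue F n) atTop = 0

/-! ### The uniform martingale law of large numbers

A conditional expectation is defined only up to null sets, so the supremum of an uncountable
family of them is the essential supremum. Its expectation is the supremum, over the countable
subclasses `G` of `F`, of the expectation of the pointwise supremum over `G`; when `F` is itself
countable this is the expectation of the pointwise supremum over `F`. -/

/-- The mean over `μ` of `sup_{f ∈ G} |1/n ∑_{t=1}^n (f(X_t) - E[f(X_t) | 𝒜_{t-1}])|`; here
`ξ t` is `X_{t+1}`. -/
def martingaleDeviation {X : Type u} (G : Set (X → Bool)) (n : ℕ) {Ω : Type u}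
    {mΩ : MeasurableSpace Ω} (μ : Measure Ω) (𝒜 : Filtration ℕ mΩ) (ξ : ℕ → Ω → X) : ℝ :=
  ∫ ω, ⨆ f : G, |(1 / (n : ℝ)) * ∑ t ∈ Finset.range n,
    (sgn (f.1 (ξ t ω)) - (μ[fun ω' => sgn (f.1 (ξ t ω')) | 𝒜 t]) ω)| ∂μ

/-- The worst case of the expected deviation, over all probability spaces, filtrations and
adapted processes (`X_{t+1}` is `𝒜_{t+1}`-measurable). -/
def martingaleValue {X : Type u} [MeasurableSpace X] (F : Set (X → Bool)) (n : ℕ) : ℝ :=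
  sSup {a : ℝ | ∃ (Ω : Type u) (mΩ : MeasurableSpace Ω) (μ : Measure Ω)
    (𝒜 : Filtration ℕ mΩ) (ξ : ℕ → Ω → X) (G : Set (X → Bool)),
    IsProbabilityMeasure μ ∧ (∀ t, Measurable[𝒜 (t + 1)] (ξ t)) ∧
    G ⊆ F ∧ G.Countable ∧ G.Nonempty ∧ a = martingaleDeviation G n μ 𝒜 ξ}

def UMLLN {X : Type u} [MeasurableSpace X] (F : Set (X → Bool)) : Prop :=
  limsup (fun n : ℕ => martingaleValue F n) atTop = 0

/-! ### Prequential learnability -/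

/-- The upper (outer) expectation of a bounded function, which need not be measurable. It is
`∫ x, h x ∂μ` when `h` is measurable. -/
def upperExp {α : Type*} [MeasurableSpace α] (μ : Measure α) (h : α → ℝ) : ℝ :=
  sInf {a : ℝ | ∃ g : α → ℝ, Measurable g ∧ Integrable g μ ∧ (∀ x, h x ≤ g x) ∧ a = ∫ x, g x ∂μ}

/-- A stochastic process `Z₁, Z₂, …` on `X × Bool`, given by the conditional laws
`P t = P_{t+1}(· ; z_{1:t})` of `Z_{t+1}` given `Z_{1:t} = z_{1:t}`. They determine the joint law
of `Z_{1:n}`, and every joint law that has regular conditional distributions arises in this way. -/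
abbrev CondLaws (X : Type u) [MeasurableSpace X] : Type u :=
  (t : ℕ) → Kernel (Fin t → X × Bool) (X × Bool)

/-- Expectation of `φ(Z_{1:n})` under the process with conditional laws `P`, computed by
integrating out `Z_n`, …, `Z_1` in turn. For measurable `φ` this is the integral of `φ` against
the joint law; upper expectations are used since a learning rule is an arbitrary map of the
history. -/
def processExp {X : Type u} [MeasurableSpace X] (P : CondLaws X) :
    (n : ℕ) → ((Fin n → X × Bool) → ℝ) → ℝ
  | 0, φ => φ Fin.elim0
  | n + 1, φ => processExp P n (fun h => upperExp (P n h) (fun z => φ (Fin.snoc h z)))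

/-- `ℓ(P, f)`, the expected loss of a fixed function. -/
def risk {X : Type u} [MeasurableSpace X] (P : Measure (X × Bool)) (f : X → Bool) : ℝ :=
  ∫ z, loss z f ∂P

/-- `ℓ(P, f)` averaged over a random function `f` with law `q` (`z` and `f` being independent). -/
def randRisk {X : Type u} [MeasurableSpace X] {F : Set (X → Bool)} (P : Measure (X × Bool))
    (q : ProbabilityMeasure F) : ℝ :=
  upperExp P (fun z => randLoss z q)

/-- `1/n ∑_t ℓ(P_t, f̂_{t-1}) - inf_{f ∈ G} 1/n ∑_t ℓ(P_t, f)` along the realized path `z`. -/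
def preqRegret {X : Type u} [MeasurableSpace X] {F : Set (X → Bool)} (A : Rules F)
    (G : Set (X → Bool)) (P : CondLaws X) {n : ℕ} (z : Fin n → X × Bool) : ℝ :=
  (1 / (n : ℝ)) * (∑ t : Fin n, randRisk (P t (past z t)) (A t (past z t))) -
    ⨅ f : G, (1 / (n : ℝ)) * ∑ t : Fin n, risk (P t (past z t)) f.1

/-- Worst case, over all processes, of the expected prequential regret. As for the martingale law,
the infimum over `f ∈ F` of the conditional risks is the essential infimum, whence the countable
subclasses `G`. -/
def preqWorst {X : Type u} [MeasurableSpace X] {F : Set (X → Bool)} (A : Rules F) (n : ℕ) : ℝ :=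
  sSup {a : ℝ | ∃ (P : CondLaws X) (G : Set (X → Bool)), (∀ t, IsMarkovKernel (P t)) ∧
    G ⊆ F ∧ G.Countable ∧ G.Nonempty ∧ a = processExp P n (fun z => preqRegret A G P z)}

/-- The minimax value of the prequential game with `n` rounds. -/
def preqValue {X : Type u} [MeasurableSpace X] (F : Set (X → Bool)) (n : ℕ) : ℝ :=
  ⨅ A : Rules F, preqWorst A n

def PrequentiallyLearnable {X : Type u} [MeasurableSpace X] (F : Set (X → Bool)) : Prop :=
  limsup (fun n : ℕ => preqValue F n) atTop = 0

end

end Learn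

namespace Learn

noncomputable section


/-! ### Bounded functions and means -/

/-! Every condition is compared with finite Littlestone dimension, and one deterministic game
carries all the upper bounds. In `pot` an adversary picks a point, a vector indexed by the function
class moves by plus or minus the gain of that point under a fair coin, and the payoff at the end is
the supremum of the vector (`supT`) or of its absolute values (`absT`).

If no tree of depth `D` is shattered, the value of this game is small. For the exponential payoff,
every point splits the class into two halves by predicted label, and one of them fails to shatter
trees of smaller depth. Pascal's recursion then bounds the potential by a polynomial in `n` times
`cosh r ^ n` (`pot_expT_le`), and a tangent line turns this into a bound of order `D log n / r + n r
/ 2` (`pot_absT_le`).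

A tree is a strategy of the adversary, which settles Rademacher complexity (`treeMean_le_pot`). The
other bounds rest on `pot_symmetrization`: a centred step averaged over any mean costs at most one
round. For online learning, if no mixed prediction were good enough, Hahn-Banach would give a
finitely additive mixed strategy of the adversary that contradicts symmetrization
(`exists_isWeight_le`). For the martingale law, the mean is the conditional distribution of the
finitely many label patterns (`integral_pot_step_le`). For prequential learning, the online rules
are reused and symmetrization controls the passage from losses to conditional risks
(`upperExp_preqPot_le`).

Conversely, suppose trees of all depths are shattered. Any rule errs with probability at least one
half all along some path that a function in the class labels perfectly (`exists_path_half_le`);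
point masses turn that path into a process. The Rademacher complexity is then at least one, and a
walk choosing between the current node and the root violates the martingale law
(`le_martingaleDeviation`). -/

/-- The real function `u` is bounded. -/
def FunBdd {W : Type*} (u : W → ℝ) : Prop := ∃ C, ∀ w, |u w| ≤ C

namespace FunBdd

variable {W : Type*} {u v : W → ℝ}

theorem const (c : ℝ) : FunBdd (fun _ : W => c) := ⟨|c|, fun _ => le_rfl⟩

theorem add (hu : FunBdd u) (hv : FunBdd v) : FunBdd (u + v) := by
  obtain ⟨C, hC⟩ := hu
  obtain ⟨D, hD⟩ := hv
  exact ⟨C + D, fun w => (abs_add_le _ _).trans (add_le_add (hC w) (hD w))⟩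

theorem smul (c : ℝ) (hu : FunBdd u) : FunBdd (c • u) := by
  obtain ⟨C, hC⟩ := hu
  refine ⟨|c| * C, fun w => ?_⟩
  simp only [Pi.smul_apply, smul_eq_mul, abs_mul]
  exact mul_le_mul_of_nonneg_left (hC w) (abs_nonneg c)

theorem neg (hu : FunBdd u) : FunBdd (-u) := by
  obtain ⟨C, hC⟩ := hu
  exact ⟨C, fun w => by simpa using hC w⟩

theorem sub (hu : FunBdd u) (hv : FunBdd v) : FunBdd (u - v) := by
  rw [sub_eq_add_neg]
  exact hu.add hv.neg

theorem bddAbove (hu : FunBdd u) : BddAbove (Set.range u) := by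
  obtain ⟨C, hC⟩ := hu
  exact ⟨C, by rintro _ ⟨w, rfl⟩; exact (abs_le.1 (hC w)).2⟩

theorem of_finite [Finite W] (u : W → ℝ) : FunBdd u := by
  obtain ⟨C, hC⟩ := (Set.finite_range fun w => |u w|).bddAbove
  exact ⟨C, fun w => hC ⟨w, rfl⟩⟩

end FunBdd

/-- A mean: a positive normalized linear functional on the bounded functions on `W`. -/
structure IsMean {W : Type*} (μ : (W → ℝ) → ℝ) : Prop where
  add : ∀ u v, FunBdd u → FunBdd v → μ (u + v) = μ u + μ v
  smul : ∀ (c : ℝ) u, FunBdd u → μ (c • u) = c * μ u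
  mono : ∀ u v, FunBdd u → FunBdd v → (∀ w, u w ≤ v w) → μ u ≤ μ v
  const : ∀ c : ℝ, μ (fun _ => c) = c

namespace IsMean

variable {W : Type*} {μ : (W → ℝ) → ℝ}

theorem sub (hμ : IsMean μ) {u v : W → ℝ} (hu : FunBdd u) (hv : FunBdd v) :
    μ (u - v) = μ u - μ v := by
  have h : u - v = u + (-1 : ℝ) • v := by simp [sub_eq_add_neg]
  rw [h, hμ.add _ _ hu (hv.smul _), hμ.smul _ _ hv]
  ring

theorem le_of_forall_le (hμ : IsMean μ) {u : W → ℝ} (hu : FunBdd u) {c : ℝ}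
    (h : ∀ w, u w ≤ c) : μ u ≤ c := by
  have := hμ.mono u (fun _ => c) hu (FunBdd.const c) h
  rwa [hμ.const] at this

theorem abs_le (hμ : IsMean μ) {u : W → ℝ} {c : ℝ} (h : ∀ w, |u w| ≤ c) : |μ u| ≤ c := by
  have hu : FunBdd u := ⟨c, h⟩
  refine _root_.abs_le.2 ⟨?_, hμ.le_of_forall_le hu fun w => (_root_.abs_le.1 (h w)).2⟩
  have := hμ.mono (fun _ => -c) u (FunBdd.const _) hu fun w => (_root_.abs_le.1 (h w)).1
  rwa [hμ.const] at this

theorem const_add (hμ : IsMean μ) (c : ℝ) {u : W → ℝ} (hu : FunBdd u) :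
    μ (fun w => c + u w) = c + μ u := by
  have := hμ.add (fun _ => c) u (FunBdd.const c) hu
  rwa [hμ.const] at this

end IsMean

/-- The mean of two values. -/
def boolMean (u : Bool → ℝ) : ℝ := (u true + u false) / 2

theorem isMean_boolMean : IsMean boolMean where
  add u v _ _ := by simp only [boolMean, Pi.add_apply]; ring
  smul c u _ := by simp only [boolMean, Pi.smul_apply, smul_eq_mul]; ring
  mono u v _ _ h := by
    have h1 := h true
    have h2 := h false
    simp only [boolMean]
    linarith
  const c := by simp only [boolMean]; ring

/-- The weighted mean over a finite type. -/
theorem isMean_weights {W : Type*} [Fintype W] {p : W → ℝ} (hp : ∀ w, 0 ≤ p w)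
    (hsum : ∑ w, p w = 1) : IsMean (fun u : W → ℝ => ∑ w, p w * u w) where
  add u v _ _ := by simp [mul_add, Finset.sum_add_distrib]
  smul c u _ := by
    simp only [Pi.smul_apply, smul_eq_mul, Finset.mul_sum]
    exact Finset.sum_congr rfl fun _ _ => by ring
  mono u v _ _ h := Finset.sum_le_sum fun w _ => mul_le_mul_of_nonneg_left (h w) (hp w)
  const c := by simp only [← Finset.sum_mul, hsum, one_mul]

/-- A sublinear functional on bounded functions that is dominated by the supremum is the upper
envelope of the means that it dominates (Hahn-Banach). -/
theorem exists_isMean_le {W : Type*} (N : (W → ℝ) → ℝ)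
    (hsmul : ∀ c : ℝ, 0 < c → ∀ u, FunBdd u → N (c • u) = c * N u)
    (hadd : ∀ u v, FunBdd u → FunBdd v → N (u + v) ≤ N u + N v)
    (hle : ∀ u (c : ℝ), FunBdd u → (∀ w, u w ≤ c) → N u ≤ c) (u₀ : W → ℝ) (hu₀ : FunBdd u₀) :
    ∃ μ, IsMean μ ∧ (∀ u, FunBdd u → μ u ≤ N u) ∧ μ u₀ = N u₀ := by
  let E : Submodule ℝ (W → ℝ) :=
    { carrier := {u | FunBdd u}
      add_mem' := fun ha hb => ha.add hb
      zero_mem' := FunBdd.const 0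
      smul_mem' := fun c _ hu => hu.smul c }
  have hN0 : N 0 = 0 := by
    have := hsmul 2 two_pos 0 (FunBdd.const 0)
    rw [smul_zero] at this
    linarith
  let x₀ : E := ⟨u₀, hu₀⟩
  have H : ∀ c : ℝ, c • x₀ = 0 → c • N u₀ = 0 := by
    intro c hc
    rcases smul_eq_zero.1 hc with h | h
    · simp [h]
    · have : u₀ = 0 := congrArg Subtype.val h
      rw [this, hN0, smul_zero]
  obtain ⟨L, hL1, hL2⟩ := exists_extension_of_le_sublinear
    (LinearPMap.mkSpanSingleton' x₀ (N u₀) H) (fun u : E => N u.1)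
    (fun c hc u => hsmul c hc u.1 u.2) (fun u v => hadd u.1 v.1 u.2 v.2) (by
      rintro ⟨y, hy⟩
      obtain ⟨c, rfl⟩ := Submodule.mem_span_singleton.1 hy
      rw [LinearPMap.mkSpanSingleton'_apply]
      change c • N u₀ ≤ N (c • u₀)
      rcases lt_trichotomy c 0 with hc | hc | hc
      -- For negative multiples, domination comes from subadditivity at two opposite vectors
      -- together with `N 0 = 0`.
      · have h1 := hadd (c • u₀) ((-c) • u₀) (hu₀.smul _) (hu₀.smul _)
        rw [← add_smul, add_neg_cancel, zero_smul, hN0, hsmul (-c) (by linarith) u₀ hu₀] at h1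
        rw [smul_eq_mul]
        linarith
      · simp [hc, hN0]
      · rw [hsmul c hc u₀ hu₀, smul_eq_mul])
  classical
  let μ : (W → ℝ) → ℝ := fun u => if h : FunBdd u then L ⟨u, h⟩ else 0
  have hμ : ∀ u (h : FunBdd u), μ u = L ⟨u, h⟩ := fun u h => dif_pos h
  have hμN : ∀ u, FunBdd u → μ u ≤ N u := fun u h => by rw [hμ u h]; exact hL2 ⟨u, h⟩
  have hμadd : ∀ u v, FunBdd u → FunBdd v → μ (u + v) = μ u + μ v := fun u v hu hv => by
    rw [hμ _ (hu.add hv), hμ u hu, hμ v hv, ← map_add]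
    rfl
  have hμsmul : ∀ (c : ℝ) u, FunBdd u → μ (c • u) = c * μ u := fun c u hu => by
    rw [hμ _ (hu.smul c), hμ u hu, ← smul_eq_mul, ← map_smul]
    rfl
  refine ⟨μ, ⟨hμadd, hμsmul, ?_, ?_⟩, hμN, ?_⟩
  · intro u v hu hv h
    have h1 := (hμN _ (hu.add (hv.smul (-1)))).trans
      (hle _ 0 (hu.add (hv.smul (-1))) fun w => by
        have := h w
        simp only [Pi.add_apply, Pi.smul_apply, smul_eq_mul]
        linarith)
    rw [hμadd _ _ hu (hv.smul _), hμsmul _ _ hv] at h1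
    linarith
  · intro c
    have h1 := (hμN _ (FunBdd.const c)).trans (hle _ c (FunBdd.const c) fun _ => le_rfl)
    have h2 := (hμN _ ((FunBdd.const c).smul (-1))).trans
      (hle _ (-c) ((FunBdd.const c).smul (-1)) fun w => by simp)
    rw [hμsmul _ _ (FunBdd.const c)] at h2
    linarith
  · rw [hμ u₀ hu₀]
    have := hL1 ⟨x₀, Submodule.mem_span_singleton_self x₀⟩
    rw [this]
    exact LinearPMap.mkSpanSingleton'_apply_self x₀ (N u₀) H _


/-! ### The sequential potential -/

section Potential

variable {Z I : Type*} (g : Z → I → ℝ)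

/-- The value of the game with `k` rounds in which an adversary chooses a point `z`, the
accumulated vector `S` moves by `± g z` with equal probability, and the final payoff is `T S`. -/
def pot (T : (I → ℝ) → ℝ) : ℕ → (I → ℝ) → ℝ
  | 0, S => T S
  | k + 1, S => ⨆ z, (pot T k (S + g z) + pot T k (S - g z)) / 2

/-- `T` is bounded on uniformly bounded vectors. -/
def UnifBdd (T : (I → ℝ) → ℝ) : Prop := ∀ C, ∃ M, ∀ S : I → ℝ, (∀ i, |S i| ≤ C) → |T S| ≤ M

/-- Jensen's inequality for the functional `T` and the mean `μ`. -/
def Jensen {W : Type*} (μ : (W → ℝ) → ℝ) (T : (I → ℝ) → ℝ) : Prop :=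
  ∀ S : W → I → ℝ, (∃ C, ∀ w i, |S w i| ≤ C) →
    T (fun i => μ (fun w => S w i)) ≤ μ (fun w => T (S w))

variable {g} {T : (I → ℝ) → ℝ}

theorem UnifBdd.funBdd (hT : UnifBdd T) {W : Type*} {S : W → I → ℝ}
    (hS : ∃ C, ∀ w i, |S w i| ≤ C) : FunBdd (fun w => T (S w)) := by
  obtain ⟨C, hC⟩ := hS
  obtain ⟨M, hM⟩ := hT C
  exact ⟨M, fun w => hM _ (hC w)⟩

theorem unifBdd_pot [Nonempty Z] (hg : ∀ z i, |g z i| ≤ 1) (hT : UnifBdd T) (k : ℕ) :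
    UnifBdd (pot g T k) := by
  induction k with
  | zero => exact hT
  | succ k ih =>
    intro C
    obtain ⟨M, hM⟩ := ih (C + 1)
    refine ⟨M, fun S hS => ?_⟩
    have h1 : ∀ z, |(pot g T k (S + g z) + pot g T k (S - g z)) / 2| ≤ M := fun z => by
      have ha := hM (S + g z) fun i => (abs_add_le _ _).trans (add_le_add (hS i) (hg z i))
      have hb := hM (S - g z) fun i => (abs_sub _ _).trans (add_le_add (hS i) (hg z i))
      rw [abs_le] at ha hb ⊢
      constructor <;> linarith [ha.1, ha.2, hb.1, hb.2]
    have hbdd : FunBdd fun z => (pot g T k (S + g z) + pot g T k (S - g z)) / 2 := ⟨M, h1⟩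
    obtain ⟨z₀⟩ := ‹Nonempty Z›
    refine abs_le.2 ⟨(abs_le.1 (h1 z₀)).1.trans (le_ciSup hbdd.bddAbove z₀), ?_⟩
    have : Nonempty Z := ⟨z₀⟩
    exact ciSup_le fun z => (abs_le.1 (h1 z)).2

theorem exists_abs_add_le (hg : ∀ z i, |g z i| ≤ 1) {S : I → ℝ} (hS : FunBdd S) :
    ∃ C, ∀ z i, |(S + g z) i| ≤ C := by
  obtain ⟨C, hC⟩ := hS
  exact ⟨C + 1, fun z i => (abs_add_le _ _).trans (add_le_add (hC i) (hg z i))⟩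

theorem exists_abs_sub_le (hg : ∀ z i, |g z i| ≤ 1) {S : I → ℝ} (hS : FunBdd S) :
    ∃ C, ∀ z i, |(S - g z) i| ≤ C := by
  obtain ⟨C, hC⟩ := hS
  exact ⟨C + 1, fun z i => (abs_sub _ _).trans (add_le_add (hC i) (hg z i))⟩

theorem le_pot_succ [Nonempty Z] (hg : ∀ z i, |g z i| ≤ 1) (hT : UnifBdd T) (k : ℕ) {S : I → ℝ}
    (hS : FunBdd S) (z : Z) :
    (pot g T k (S + g z) + pot g T k (S - g z)) / 2 ≤ pot g T (k + 1) S := by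
  have h := (((unifBdd_pot hg hT k).funBdd (exists_abs_add_le hg hS)).add
    ((unifBdd_pot hg hT k).funBdd (exists_abs_sub_le hg hS))).smul (1 / 2)
  have h' : FunBdd fun z => (pot g T k (S + g z) + pot g T k (S - g z)) / 2 := by
    convert h using 2
    simp only [Pi.smul_apply, Pi.add_apply, smul_eq_mul]
    ring
  exact le_ciSup h'.bddAbove z

theorem FunBdd.of_abs_le_one {z : Z} (hg : ∀ z i, |g z i| ≤ 1) : FunBdd (g z) := ⟨1, hg z⟩

/-- Each round is a supremum of averages, hence monotone, subadditive and compatible with constants,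
so the comparison survives backward induction. The two summands will be the halves of a class split
by label, or the exponents `r` and `-r`. -/
theorem pot_le_combination [Nonempty Z] (hg : ∀ z i, |g z i| ≤ 1) {T₁ T₂ : (I → ℝ) → ℝ}
    (hT₁ : UnifBdd T₁) (hT₂ : UnifBdd T₂) {a b : ℝ} (ha : 0 ≤ a)
    (h : ∀ S, FunBdd S → T S ≤ a * (T₁ S + T₂ S) + b) (k : ℕ) (S : I → ℝ) (hS : FunBdd S) :
    pot g T k S ≤ a * (pot g T₁ k S + pot g T₂ k S) + b := by
  induction k generalizing S with
  | zero => exact h S hS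
  | succ k ih =>
    refine ciSup_le fun z => ?_
    have hz : FunBdd (g z) := FunBdd.of_abs_le_one hg
    have h1 := ih _ (hS.add hz)
    have h2 := ih _ (hS.sub hz)
    have h3 := mul_le_mul_of_nonneg_left (le_pot_succ hg hT₁ k hS z) ha
    have h4 := mul_le_mul_of_nonneg_left (le_pot_succ hg hT₂ k hS z) ha
    linarith

theorem pot_add_le [Nonempty Z] (hg : ∀ z i, |g z i| ≤ 1) (hT : UnifBdd T)
    (h : ∀ S S' : I → ℝ, ∀ c : ℝ, FunBdd S → FunBdd S' → (∀ i, S i + c ≤ S' i) → T S + c ≤ T S')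
    (k : ℕ) {S S' : I → ℝ} {c : ℝ} (hS : FunBdd S) (hS' : FunBdd S')
    (hc : ∀ i, S i + c ≤ S' i) : pot g T k S + c ≤ pot g T k S' := by
  induction k generalizing S S' with
  | zero => exact h S S' c hS hS' hc
  | succ k ih =>
    rw [← le_sub_iff_add_le]
    refine ciSup_le fun z => ?_
    have hz : FunBdd (g z) := FunBdd.of_abs_le_one hg
    have h1 := ih (hS.add hz) (hS'.add hz) fun i => by
      simp only [Pi.add_apply]; linarith [hc i]
    have h2 := ih (hS.sub hz) (hS'.sub hz) fun i => by
      simp only [Pi.sub_apply]; linarith [hc i]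
    have h3 := le_pot_succ hg hT k hS' z
    linarith

theorem pot_lipschitz [Nonempty Z] (hg : ∀ z i, |g z i| ≤ 1) (hT : UnifBdd T)
    (h : ∀ S S' : I → ℝ, ∀ c : ℝ, FunBdd S → FunBdd S' → (∀ i, |S i - S' i| ≤ c) →
      T S ≤ T S' + c)
    (k : ℕ) {S S' : I → ℝ} {c : ℝ} (hS : FunBdd S) (hS' : FunBdd S')
    (hc : ∀ i, |S i - S' i| ≤ c) : pot g T k S ≤ pot g T k S' + c := by
  induction k generalizing S S' with
  | zero => exact h S S' c hS hS' hc
  | succ k ih =>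
    refine ciSup_le fun z => ?_
    have hz : FunBdd (g z) := FunBdd.of_abs_le_one hg
    have h1 := ih (hS.add hz) (hS'.add hz) fun i => by simpa using hc i
    have h2 := ih (hS.sub hz) (hS'.sub hz) fun i => by simpa using hc i
    have h3 := le_pot_succ hg hT k hS' z
    linarith

/-- For fixed `z`, translation by `± g z` commutes with taking means, so both branches inherit
Jensen's inequality; the supremum over `z` passes inside the mean by monotonicity. -/
theorem jensen_pot [Nonempty Z] (hg : ∀ z i, |g z i| ≤ 1) (hT : UnifBdd T) {W : Type*}
    {μ : (W → ℝ) → ℝ} (hμ : IsMean μ) (hJ : Jensen μ T) (k : ℕ) : Jensen μ (pot g T k) := by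
  induction k with
  | zero => exact hJ
  | succ k ih =>
    rintro S ⟨C, hC⟩
    refine ciSup_le fun z => ?_
    have hcol : ∀ i, FunBdd fun w => S w i := fun i => ⟨C, fun w => hC w i⟩
    have hS : ∀ w, FunBdd (S w) := fun w => ⟨C, hC w⟩
    have hadd : ∃ C, ∀ w i, |(S w + g z) i| ≤ C :=
      ⟨C + 1, fun w i => (abs_add_le _ _).trans (add_le_add (hC w i) (hg z i))⟩
    have hsub : ∃ C, ∀ w i, |(S w - g z) i| ≤ C :=
      ⟨C + 1, fun w i => (abs_sub _ _).trans (add_le_add (hC w i) (hg z i))⟩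
    have e1 : ((fun i => μ fun w => S w i) + g z) = fun i => μ fun w => (S w + g z) i := by
      ext i
      have := hμ.const_add (g z i) (hcol i)
      simp only [Pi.add_apply]
      rw [add_comm, ← this]
      congr 1
      ext w
      ring
    have e2 : ((fun i => μ fun w => S w i) - g z) = fun i => μ fun w => (S w - g z) i := by
      ext i
      have := hμ.const_add (-g z i) (hcol i)
      simp only [Pi.sub_apply]
      rw [sub_eq_add_neg, add_comm, ← this]
      congr 1
      ext w
      ring
    have b1 := (unifBdd_pot hg hT k).funBdd hadd
    have b2 := (unifBdd_pot hg hT k).funBdd hsub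
    have b3 := (unifBdd_pot hg hT (k + 1)).funBdd (S := S) ⟨C, hC⟩
    have h1 := ih _ hadd
    have h2 := ih _ hsub
    rw [e1, e2]
    have h3 : (1 / 2 : ℝ) * (μ (fun w => pot g T k (S w + g z)) +
        μ (fun w => pot g T k (S w - g z))) ≤ μ fun w => pot g T (k + 1) (S w) := by
      rw [← hμ.add _ _ b1 b2, ← hμ.smul _ _ (b1.add b2)]
      refine hμ.mono _ _ ((b1.add b2).smul _) b3 fun w => ?_
      have := le_pot_succ hg hT k (hS w) z
      simp only [Pi.smul_apply, Pi.add_apply, smul_eq_mul]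
      linarith
    linarith

/-- Symmetrization: one centred step, averaged over an arbitrary mean, is dominated by one more
round of the game. -/
theorem pot_symmetrization [Nonempty Z] (hg : ∀ z i, |g z i| ≤ 1) (hT : UnifBdd T) {W : Type*}
    {μ : (W → ℝ) → ℝ} (hμ : IsMean μ) (hJ : Jensen μ T) (hJ₂ : Jensen boolMean T) (k : ℕ)
    (ζ : W → Z) {S : I → ℝ} (hS : FunBdd S) :
    μ (fun w => pot g T k fun i => S i + (g (ζ w) i - μ fun w' => g (ζ w') i) / 2) ≤
      pot g T (k + 1) S := by
  obtain ⟨C, hC⟩ := hS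
  have hS : FunBdd S := ⟨C, hC⟩
  set m : I → ℝ := fun i => μ fun w' => g (ζ w') i with hm
  have hm1 : ∀ i, |m i| ≤ 1 := fun i => hμ.abs_le fun w => hg _ i
  have hsub : ∃ C, ∀ w i, |(S - g (ζ w)) i| ≤ C :=
    ⟨C + 1, fun w i => (abs_sub _ _).trans (add_le_add (hC i) (hg _ i))⟩
  have hadd : ∃ C, ∀ w i, |(S + g (ζ w)) i| ≤ C :=
    ⟨C + 1, fun w i => (abs_add_le _ _).trans (add_le_add (hC i) (hg _ i))⟩
  have b1 := (unifBdd_pot hg hT k).funBdd hadd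
  have b2 := (unifBdd_pot hg hT k).funBdd hsub
  have hcentre : ∃ C, ∀ w i, |S i + (g (ζ w) i - m i) / 2| ≤ C := by
    refine ⟨C + 1, fun w i => (abs_add_le _ _).trans (add_le_add (hC i) ?_)⟩
    have h1 := abs_le.1 (hg (ζ w) i)
    have h2 := abs_le.1 (hm1 i)
    rw [abs_le]
    constructor <;> linarith [h1.1, h1.2, h2.1, h2.2]
  have b0 := (unifBdd_pot hg hT k).funBdd hcentre
  -- The compensator `m` is itself a mean of gains, so Jensen replaces it by a fresh copy of the
  -- step.
  have h1 : pot g T k (S - m) ≤ μ fun w => pot g T k (S - g (ζ w)) := by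
    have := jensen_pot hg hT hμ hJ k _ hsub
    convert this using 2
    ext i
    have h2 := hμ.sub (u := fun _ : W => S i) (v := fun w => g (ζ w) i) (FunBdd.const _)
      ⟨1, fun w => hg _ i⟩
    rw [hμ.const] at h2
    exact h2.symm
  -- The factor one half makes the centred position the midpoint of `S + g` and `S - m`, so midpoint
  -- convexity separates the two terms.
  have h2 : ∀ w, pot g T k (fun i => S i + (g (ζ w) i - m i) / 2) ≤
      (1 / 2 : ℝ) * pot g T k (S - m) + (1 / 2) * pot g T k (S + g (ζ w)) := fun w => by
    have hb : ∃ C, ∀ (b : Bool) i, |(if b then S + g (ζ w) else S - m) i| ≤ C := by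
      refine ⟨C + 1, fun b i => ?_⟩
      cases b
      · simpa using (abs_sub _ _).trans (add_le_add (hC i) (hm1 i))
      · simpa using (abs_add_le _ _).trans (add_le_add (hC i) (hg (ζ w) i))
    have := jensen_pot hg hT isMean_boolMean hJ₂ k
      (fun b => if b then S + g (ζ w) else S - m) hb
    simp only [boolMean, if_true, Bool.false_eq_true, if_false] at this
    have e : (fun i => S i + (g (ζ w) i - m i) / 2) =
        fun i => ((S + g (ζ w)) i + (S - m) i) / 2 := by
      ext i
      simp only [Pi.add_apply, Pi.sub_apply]
      ring
    rw [e]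
    linarith
  calc μ (fun w => pot g T k fun i => S i + (g (ζ w) i - m i) / 2)
      ≤ μ (fun w => (1 / 2 : ℝ) * pot g T k (S - m) + ((1 / 2 : ℝ) •
          fun w => pot g T k (S + g (ζ w))) w) :=
        hμ.mono _ _ b0 ((FunBdd.const _).add (b1.smul _)) h2
    _ = (1 / 2 : ℝ) * pot g T k (S - m) + (1 / 2) * μ (fun w => pot g T k (S + g (ζ w))) := by
        rw [hμ.const_add _ (b1.smul _), hμ.smul _ _ b1]
    _ ≤ (1 / 2 : ℝ) * (μ (fun w => pot g T k (S + g (ζ w))) +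
          μ (fun w => pot g T k (S - g (ζ w)))) := by linarith
    _ = μ ((1 / 2 : ℝ) • ((fun w => pot g T k (S + g (ζ w))) +
          fun w => pot g T k (S - g (ζ w)))) := by
        rw [hμ.smul _ _ (b1.add b2), hμ.add _ _ b1 b2]
    _ ≤ pot g T (k + 1) S := by
        refine hμ.le_of_forall_le ((b1.add b2).smul _) fun w => ?_
        have := le_pot_succ hg hT k hS (ζ w)
        simp only [Pi.smul_apply, Pi.add_apply, smul_eq_mul]
        linarith

end Potential

/-! ### Terminal functionals -/

section Terminal

variable {I : Type*}

/-- The supremum of a vector. -/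
def supT (S : I → ℝ) : ℝ := ⨆ i, S i

/-- The supremum of the absolute values of a vector. -/
def absT (S : I → ℝ) : ℝ := ⨆ i, |S i|

open Classical in
/-- The supremum over the indices in `V` of the exponentials of a multiple of a vector. -/
def expT (V : Set I) (r : ℝ) (S : I → ℝ) : ℝ := ⨆ i, if i ∈ V then Real.exp (r * S i) else 0

theorem FunBdd.abs {W : Type*} {u : W → ℝ} (hu : FunBdd u) : FunBdd fun w => |u w| := by
  obtain ⟨C, hC⟩ := hu
  exact ⟨C, fun w => by simpa using hC w⟩

theorem le_expT {V : Set I} {r : ℝ} {S : I → ℝ} (hS : FunBdd S) {i : I} (hi : i ∈ V) :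
    Real.exp (r * S i) ≤ expT V r S := by
  classical
  obtain ⟨C, hC⟩ := hS
  have hb : FunBdd fun i => if i ∈ V then Real.exp (r * S i) else 0 := by
    refine ⟨Real.exp (|r| * C), fun i => ?_⟩
    dsimp only
    split_ifs
    · rw [abs_of_pos (Real.exp_pos _)]
      refine Real.exp_le_exp.2 ((le_abs_self _).trans ?_)
      rw [abs_mul]
      exact mul_le_mul_of_nonneg_left (hC i) (abs_nonneg r)
    · simp [Real.exp_nonneg]
  have := le_ciSup hb.bddAbove i
  rw [if_pos hi] at this
  exact this

variable [Nonempty I]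

theorem unifBdd_supT : UnifBdd (supT : (I → ℝ) → ℝ) := fun C => ⟨C, fun S hS => by
  have hb : FunBdd S := ⟨C, hS⟩
  obtain ⟨i⟩ := ‹Nonempty I›
  exact abs_le.2 ⟨(abs_le.1 (hS i)).1.trans (le_ciSup hb.bddAbove i),
    haveI : Nonempty I := ⟨i⟩; ciSup_le fun i => (abs_le.1 (hS i)).2⟩⟩

theorem unifBdd_absT : UnifBdd (absT : (I → ℝ) → ℝ) := fun C => ⟨C, fun S hS => by
  have h0 : 0 ≤ absT S := Real.iSup_nonneg fun i => abs_nonneg _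
  rw [abs_of_nonneg h0]
  exact ciSup_le hS⟩

theorem unifBdd_expT (V : Set I) (r : ℝ) : UnifBdd (expT V r) := fun C =>
  ⟨Real.exp (|r| * C), fun S hS => by
    classical
    have h0 : 0 ≤ expT V r S := Real.iSup_nonneg fun i => by split_ifs <;> positivity
    rw [abs_of_nonneg h0]
    refine ciSup_le fun i => ?_
    split_ifs
    · refine Real.exp_le_exp.2 ((le_abs_self _).trans ?_)
      rw [abs_mul]
      exact mul_le_mul_of_nonneg_left (hS i) (abs_nonneg r)
    · positivity⟩

/-- Indices outside `V` contribute the default value zero, whence `0 ≤ c`; in particular an empty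
`V` gives zero, which starts the growth recursion. -/
theorem expT_le {V : Set I} {r : ℝ} {S : I → ℝ} {c : ℝ} (hc : 0 ≤ c)
    (h : ∀ i ∈ V, Real.exp (r * S i) ≤ c) : expT V r S ≤ c := by
  classical
  refine ciSup_le fun i => ?_
  split_ifs with hi
  · exact h i hi
  · exact hc

theorem jensen_supT {W : Type*} {μ : (W → ℝ) → ℝ} (hμ : IsMean μ) :
    Jensen μ (supT : (I → ℝ) → ℝ) := by
  rintro S ⟨C, hC⟩
  refine ciSup_le fun i => ?_
  refine hμ.mono _ _ ⟨C, fun w => hC w i⟩ (unifBdd_supT.funBdd ⟨C, hC⟩) fun w => ?_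
  have hb : FunBdd (S w) := ⟨C, hC w⟩
  exact le_ciSup hb.bddAbove i

theorem jensen_absT {W : Type*} {μ : (W → ℝ) → ℝ} (hμ : IsMean μ) :
    Jensen μ (absT : (I → ℝ) → ℝ) := by
  rintro S ⟨C, hC⟩
  refine ciSup_le fun i => ?_
  have hle : ∀ w, |S w i| ≤ absT (S w) := fun w => by
    have hb : FunBdd (S w) := ⟨C, hC w⟩
    exact le_ciSup hb.abs.bddAbove i
  have hcol : FunBdd fun w => S w i := ⟨C, fun w => hC w i⟩
  have hT := unifBdd_absT.funBdd (S := S) ⟨C, hC⟩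
  refine abs_le.2 ⟨?_, hμ.mono _ _ hcol hT fun w => (le_abs_self _).trans (hle w)⟩
  have := hμ.mono _ _ (hcol.smul (-1)) hT fun w => by
    simpa using (neg_le_abs _).trans (hle w)
  rw [hμ.smul _ _ hcol] at this
  linarith

theorem supT_add_le {S S' : I → ℝ} {c : ℝ} (hS' : FunBdd S') (h : ∀ i, S i + c ≤ S' i) :
    supT S + c ≤ supT S' := by
  rw [← le_sub_iff_add_le]
  exact ciSup_le fun i => by
    have := le_ciSup hS'.bddAbove i
    have := h i
    simp only [supT]
    linarith

theorem absT_le_add {S S' : I → ℝ} {c : ℝ} (hS' : FunBdd S') (h : ∀ i, |S i - S' i| ≤ c) :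
    absT S ≤ absT S' + c := by
  refine ciSup_le fun i => ?_
  have h1 := le_ciSup hS'.abs.bddAbove i
  have h2 := h i
  have h3 := abs_sub_abs_le_abs_sub (S i) (S' i)
  simp only [absT]
  linarith

end Terminal


/-! ### Littlestone trees and the growth of the potential -/

section Growth

variable {X I : Type*} (e : I → X → Bool)

/-- The product of the label and the prediction of the `i`-th function. -/
def gain (z : X × Bool) (i : I) : ℝ := sgn z.2 * sgn (e i z.1)

/-- The functions with indices in `V` shatter some tree of depth `D`. -/
def HasTree : ℕ → Set I → Prop
  | 0, V => V.Nonempty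
  | D + 1, V => ∃ x, HasTree D {i ∈ V | e i x = true} ∧ HasTree D {i ∈ V | e i x = false}

variable {e}

theorem abs_sgn (b : Bool) : |sgn b| = 1 := by cases b <;> simp [sgn]

theorem abs_gain_le (z : X × Bool) (i : I) : |gain e z i| ≤ 1 := by
  rw [gain, abs_mul, abs_sgn, abs_sgn, one_mul]

theorem HasTree.mono {D : ℕ} {V V' : Set I} (h : HasTree e D V) (hV : V ⊆ V') :
    HasTree e D V' := by
  induction D generalizing V V' with
  | zero => exact Set.Nonempty.mono hV h
  | succ D ih =>
    obtain ⟨x, h1, h2⟩ := h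
    exact ⟨x, ih h1 fun i hi => ⟨hV hi.1, hi.2⟩, ih h2 fun i hi => ⟨hV hi.1, hi.2⟩⟩

theorem HasTree.exists_tree {X : Type*} {e : I → X → Bool} {D : ℕ} {V : Set I}
    (h : HasTree e D V) :
    ∃ x : Tree X D, ∀ ε : Fin D → Bool, ∃ i ∈ V, ∀ t, e i (x t (past ε t)) = ε t := by
  induction D generalizing V with
  | zero =>
    obtain ⟨i, hi⟩ := h
    exact ⟨fun t => t.elim0, fun ε => ⟨i, hi, fun t => t.elim0⟩⟩
  | succ D ih =>
    obtain ⟨x₀, h1, h2⟩ := h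
    obtain ⟨y, hy⟩ := ih h1
    obtain ⟨y', hy'⟩ := ih h2
    -- Glue two trees below the root `x₀`: the first sign selects the subtree and is then dropped
    -- from the path.
    refine ⟨fun t => Fin.cases (motive := fun t : Fin (D + 1) => (Fin t → Bool) → X)
      (fun _ => x₀) (fun t η => (if η ⟨0, Nat.succ_pos _⟩ then y else y') t
        fun j => η ⟨j + 1, Nat.succ_lt_succ j.isLt⟩) t, fun ε => ?_⟩
    cases h0 : ε 0 with
    | true =>
      obtain ⟨i, hi, hit⟩ := hy (fun t => ε t.succ)
      refine ⟨i, hi.1, fun t => ?_⟩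
      refine Fin.cases ?_ (fun t => ?_) t
      · rw [h0]
        exact hi.2
      · have : past ε t.succ ⟨0, Nat.succ_pos _⟩ = true := h0
        simp only [Fin.cases_succ, this, if_true]
        exact hit t
    | false =>
      obtain ⟨i, hi, hit⟩ := hy' (fun t => ε t.succ)
      refine ⟨i, hi.1, fun t => ?_⟩
      refine Fin.cases ?_ (fun t => ?_) t
      · rw [h0]
        exact hi.2
      · have : past ε t.succ ⟨0, Nat.succ_pos _⟩ = false := h0
        simp only [Fin.cases_succ, this, Bool.false_eq_true, if_false]
        exact hit t

/-- The number of ways to choose fewer than `D` elements out of `n`. -/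
def growth : ℕ → ℕ → ℕ
  | 0, _ => 0
  | _ + 1, 0 => 1
  | D + 1, n + 1 => growth (D + 1) n + growth D n

theorem growth_le (D n : ℕ) : growth D n ≤ (n + 1) ^ D := by
  induction n generalizing D with
  | zero => cases D <;> simp [growth]
  | succ n ih =>
    cases D with
    | zero => simp [growth]
    | succ D =>
      calc growth (D + 1) n + growth D n ≤ (n + 1) ^ (D + 1) + (n + 1) ^ D :=
            add_le_add (ih _) (ih _)
        _ = (n + 1) ^ D * (n + 1 + 1) := by ring
        _ ≤ (n + 1 + 1) ^ D * (n + 1 + 1) :=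
            Nat.mul_le_mul_right _ (Nat.pow_le_pow_left (Nat.le_succ _) _)
        _ = (n + 1 + 1) ^ (D + 1) := (pow_succ _ _).symm

/-- If both halves had trees of depth `D - 1`, then `x` would be the root of a tree of depth `D`. So
the depth drops on at least one side, and Pascal's recursion adds the two counts. -/
theorem exists_growth_split {D : ℕ} {V : Set I} (h : ¬ HasTree e D V) (n : ℕ) (x : X) :
    ∃ D₁ D₂, ¬ HasTree e D₁ {i ∈ V | e i x = true} ∧ ¬ HasTree e D₂ {i ∈ V | e i x = false} ∧
      growth D₁ n + growth D₂ n ≤ growth D (n + 1) := by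
  have hmono : ∀ b, ¬ HasTree e D {i ∈ V | e i x = b} := fun b hb => h (hb.mono fun i hi => hi.1)
  cases D with
  | zero => exact ⟨0, 0, hmono _, hmono _, by simp [growth]⟩
  | succ D =>
    by_cases h1 : HasTree e D {i ∈ V | e i x = true}
    · exact ⟨D + 1, D, hmono _, fun h2 => h ⟨x, h1, h2⟩, le_rfl⟩
    · exact ⟨D, D + 1, h1, hmono _, by rw [add_comm]; rfl⟩

/-- On each half of `V` determined by the queried point, the gain is constant, so a round only
shifts the bound `s` by `± r`. Averaging over the coin gives a factor `cosh r`, the same for both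
halves, while `exists_growth_split` controls the sum of the counts. -/
theorem pot_expT_le [Nonempty X] [Nonempty I] (r : ℝ) (n D : ℕ) (V : Set I)
    (hV : ¬ HasTree e D V) (S : I → ℝ) (hS : FunBdd S) (s : ℝ) (hs : ∀ i ∈ V, r * S i ≤ s) :
    pot (gain e) (expT V r) n S ≤ growth D n * Real.cosh r ^ n * Real.exp s := by
  induction n generalizing D V S s with
  | zero =>
    refine expT_le (by positivity) fun i hi => ?_
    cases D with
    | zero => exact absurd ⟨i, hi⟩ hV
    | succ D => simpa [growth] using hs i hi
  | succ n ih =>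
    refine ciSup_le fun z => ?_
    obtain ⟨x, y⟩ := z
    obtain ⟨D₁, D₂, h1, h2, h12⟩ := exists_growth_split hV n x
    have hsplit : ∀ S, FunBdd S → expT V r S ≤ 1 * (expT {i ∈ V | e i x = true} r S +
        expT {i ∈ V | e i x = false} r S) + 0 := fun S hS => by
      have p1 : 0 ≤ expT {i ∈ V | e i x = true} r S :=
        Real.iSup_nonneg fun i => by split_ifs <;> positivity
      have p2 : 0 ≤ expT {i ∈ V | e i x = false} r S :=
        Real.iSup_nonneg fun i => by split_ifs <;> positivity
      refine expT_le (by linarith) fun i hi => ?_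
      cases hb : e i x with
      | true => linarith [le_expT (r := r) hS (show i ∈ {i ∈ V | e i x = true} from ⟨hi, hb⟩)]
      | false => linarith [le_expT (r := r) hS (show i ∈ {i ∈ V | e i x = false} from ⟨hi, hb⟩)]
    have hz : FunBdd (gain e (x, y)) := FunBdd.of_abs_le_one abs_gain_le
    have a1 := pot_le_combination (g := gain e) abs_gain_le (unifBdd_expT _ r)
      (unifBdd_expT _ r) zero_le_one hsplit n _ (hS.add hz)
    have a2 := pot_le_combination (g := gain e) abs_gain_le (unifBdd_expT _ r)
      (unifBdd_expT _ r) zero_le_one hsplit n _ (hS.sub hz)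
    have b1 := ih D₁ _ h1 _ (hS.add hz) (s + r * sgn y) fun i hi => by
      have hb : e i x = true := hi.2
      have := hs i hi.1
      simp only [Pi.add_apply, gain, hb]
      simp only [sgn, if_true]
      linarith
    have b2 := ih D₂ _ h2 _ (hS.add hz) (s - r * sgn y) fun i hi => by
      have hb : e i x = false := hi.2
      have := hs i hi.1
      simp only [Pi.add_apply, gain, hb]
      simp only [sgn, Bool.false_eq_true, if_false]
      linarith
    have b3 := ih D₁ _ h1 _ (hS.sub hz) (s - r * sgn y) fun i hi => by
      have hb : e i x = true := hi.2
      have := hs i hi.1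
      simp only [Pi.sub_apply, gain, hb]
      simp only [sgn, if_true]
      linarith
    have b4 := ih D₂ _ h2 _ (hS.sub hz) (s + r * sgn y) fun i hi => by
      have hb : e i x = false := hi.2
      have := hs i hi.1
      simp only [Pi.sub_apply, gain, hb]
      simp only [sgn, Bool.false_eq_true, if_false]
      linarith
    have hcosh : Real.exp (s + r * sgn y) + Real.exp (s - r * sgn y) =
        2 * (Real.cosh r * Real.exp s) := by
      rw [sub_eq_add_neg, Real.exp_add, Real.exp_add, Real.cosh_eq]
      cases y <;> simp [sgn] <;> ring
    have h12' : (growth D₁ n : ℝ) + growth D₂ n ≤ growth D (n + 1) := by exact_mod_cast h12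
    have hpos : 0 ≤ Real.cosh r ^ n * (Real.cosh r * Real.exp s) := by
      have := Real.cosh_pos r
      positivity
    calc (pot (gain e) (expT V r) n (S + gain e (x, y)) +
          pot (gain e) (expT V r) n (S - gain e (x, y))) / 2
        ≤ ((growth D₁ n + growth D₂ n : ℝ) * Real.cosh r ^ n *
          (Real.exp (s + r * sgn y) + Real.exp (s - r * sgn y))) / 2 := by linarith
      _ = (growth D₁ n + growth D₂ n : ℝ) * (Real.cosh r ^ n * (Real.cosh r * Real.exp s)) := by
          rw [hcosh]; ring
      _ ≤ growth D (n + 1) * (Real.cosh r ^ n * (Real.cosh r * Real.exp s)) :=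
          mul_le_mul_of_nonneg_right h12' hpos
      _ = growth D (n + 1) * Real.cosh r ^ (n + 1) * Real.exp s := by ring

/-- An upper bound for the growth of the potential, with a free parameter `r > 0`. -/
def potBound (D : ℕ) (r : ℝ) (n : ℕ) : ℝ :=
  (Real.log 2 + D * Real.log (n + 1)) / r + n * r / 2

theorem pot_absT_le [Nonempty X] [Nonempty I] {D : ℕ} (hD : ¬ HasTree e D Set.univ) {r : ℝ}
    (hr : 0 < r) (n : ℕ) : pot (gain e) absT n 0 ≤ potBound D r n := by
  -- This `c` bounds the sum of the exponential potentials for `r` and `-r`; each round costs `cosh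
  -- r ≤ exp (r ^ 2 / 2)`.
  set c : ℝ := 2 * ((n + 1) ^ D * Real.exp (n * (r ^ 2 / 2))) with hc
  have hcpos : 0 < c := by positivity
  have hlog : Real.log c = Real.log 2 + D * Real.log (n + 1) + n * (r ^ 2 / 2) := by
    rw [hc, Real.log_mul (by positivity) (by positivity),
      Real.log_mul (by positivity) (by positivity), Real.log_pow, Real.log_exp]
    ring
  have hexp : ∀ r' : ℝ, r' ^ 2 = r ^ 2 → pot (gain e) (expT Set.univ r') n 0 ≤ c / 2 := by
    intro r' hr'
    have h1 := pot_expT_le r' n D Set.univ hD 0 (FunBdd.const 0) 0 (by simp)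
    have h2 : (growth D n : ℝ) ≤ (n + 1) ^ D := by exact_mod_cast growth_le D n
    have h3 : Real.cosh r' ^ n ≤ Real.exp (n * (r ^ 2 / 2)) := by
      rw [Real.exp_nat_mul, ← hr']
      exact pow_le_pow_left₀ (Real.cosh_pos _).le (Real.cosh_le_exp_half_sq r') n
    rw [Real.exp_zero, mul_one] at h1
    refine h1.trans ?_
    have := mul_le_mul h2 h3 (pow_nonneg (Real.cosh_pos _).le _) (by positivity)
    linarith
  have hlin : ∀ S : I → ℝ, FunBdd S → absT S ≤ 1 / (r * c) *
      (expT Set.univ r S + expT Set.univ (-r) S) + (Real.log c - 1) / r := fun S hS => by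
    refine ciSup_le fun i => ?_
    have p1 := le_expT (r := r) hS (Set.mem_univ i)
    have p2 := le_expT (r := -r) hS (Set.mem_univ i)
    have p3 : Real.exp (r * |S i|) ≤ expT Set.univ r S + expT Set.univ (-r) S := by
      have q1 := Real.exp_pos (r * S i)
      have q2 := Real.exp_pos (-r * S i)
      rcases abs_cases (S i) with h | h <;> rw [h.1]
      · linarith
      · rw [mul_neg, ← neg_mul]
        linarith
    -- The tangent line of the exponential at `log c`. After division by `c` the potentials
    -- contribute at most one, which cancels the `-1` and leaves `log c / r`.
    have p4 := Real.add_one_le_exp (r * |S i| - Real.log c)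
    rw [Real.exp_sub, Real.exp_log hcpos] at p4
    have p5 : Real.exp (r * |S i|) / c ≤ (expT Set.univ r S + expT Set.univ (-r) S) / c := by
      gcongr
    have p6 : |S i| * r ≤ (expT Set.univ r S + expT Set.univ (-r) S) / c + (Real.log c - 1) := by
      linarith
    calc |S i| ≤ ((expT Set.univ r S + expT Set.univ (-r) S) / c + (Real.log c - 1)) / r :=
          (le_div_iff₀ hr).2 p6
      _ = _ := by field_simp
  have h := pot_le_combination (g := gain e) abs_gain_le (unifBdd_expT _ r)
    (unifBdd_expT _ (-r)) (by positivity) hlin n 0 (FunBdd.const 0)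
  have h1 := hexp r rfl
  have h2 := hexp (-r) (by ring)
  have h3 : 1 / (r * c) * (pot (gain e) (expT Set.univ r) n 0 +
      pot (gain e) (expT Set.univ (-r)) n 0) ≤ 1 / (r * c) * c := by
    gcongr
    linarith
  calc pot (gain e) absT n 0 ≤ 1 / (r * c) * c + (Real.log c - 1) / r := by linarith
    _ = potBound D r n := by
      rw [hlog, potBound]
      field_simp
      ring

theorem pot_supT_le [Nonempty X] [Nonempty I] {D : ℕ} (hD : ¬ HasTree e D Set.univ) {r : ℝ}
    (hr : 0 < r) (n : ℕ) : pot (gain e) supT n 0 ≤ potBound D r n := by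
  have h := pot_le_combination (T := supT) (g := gain e) (a := 1 / 2) (b := 0) abs_gain_le
    unifBdd_absT unifBdd_absT (by norm_num) (fun S hS => by
      have : supT S ≤ absT S := ciSup_le fun i =>
        (le_abs_self _).trans (le_ciSup hS.abs.bddAbove i)
      linarith) n 0 (FunBdd.const 0)
  linarith [pot_absT_le hD hr n]

theorem eventually_potBound_le (D : ℕ) {ε : ℝ} (hε : 0 < ε) :
    ∀ᶠ n : ℕ in atTop, potBound D ε n ≤ ε * n := by
  have h1 : (fun x : ℝ => Real.log 2 + D * Real.log x) =o[atTop] (fun x => x) :=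
    (Asymptotics.isLittleO_const_id_atTop _).add (Real.isLittleO_log_id_atTop.const_mul_left _)
  have h2 : Tendsto (fun n : ℕ => (n : ℝ) + 1) atTop atTop :=
    tendsto_atTop_add_const_right _ _ tendsto_natCast_atTop_atTop
  -- Since `n + 1 ≤ 2 * n`, the constant `ε ^ 2 / 4` makes the logarithmic part at most `ε * n / 2`;
  -- the quadratic part with `r = ε` is the other half.
  have h3 := (h1.comp_tendsto h2).bound (show 0 < ε ^ 2 / 4 by positivity)
  filter_upwards [h3, eventually_ge_atTop 1] with n hn hn1
  have hn1' : (1 : ℝ) ≤ n := by exact_mod_cast hn1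
  simp only [Function.comp_apply, Real.norm_eq_abs] at hn
  rw [abs_of_nonneg (show (0 : ℝ) ≤ (n : ℝ) + 1 by positivity)] at hn
  have h4 := (le_abs_self _).trans hn
  have h5 : Real.log 2 + D * Real.log (n + 1) ≤ ε * n / 2 * ε := by
    nlinarith [sq_nonneg ε]
  rw [potBound]
  have := (div_le_iff₀ hε).2 h5
  linarith

end Growth


/-! ### Upper limits -/

theorem limsup_eq_zero_of_eventually {u : ℕ → ℝ} (h0 : ∀ᶠ n in atTop, 0 ≤ u n)
    (h : ∀ ε > 0, ∀ᶠ n in atTop, u n ≤ ε) : limsup u atTop = 0 := by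
  refine Tendsto.limsup_eq (tendsto_order.2 ⟨fun a ha => ?_, fun a ha => ?_⟩)
  · filter_upwards [h0] with n hn using ha.trans_le hn
  · filter_upwards [h (a / 2) (half_pos ha)] with n hn using by linarith

/-- The upper bound `C` excludes the default value that `limsup` takes on sequences unbounded above.
-/
theorem limsup_ne_zero_of_eventually {u : ℕ → ℝ} {c C : ℝ} (hc : 0 < c)
    (hC : ∀ᶠ n in atTop, u n ≤ C) (h : ∀ᶠ n in atTop, c ≤ u n) : limsup u atTop ≠ 0 := by
  have := le_limsup_of_frequently_le h.frequently ⟨C, by simpa using hC⟩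
  exact (hc.trans_le this).ne'

/-! ### Littlestone dimension -/

section Ldim

variable {X : Type*} {F : Set (X → Bool)}

/-- `D` is chosen before the indexing, so one depth serves `F`, its countable subclasses and their
finite subfamilies alike. -/
theorem exists_not_hasTree (h : ldim F < ⊤) :
    ∃ D, ∀ {I : Type*} (e : I → X → Bool), (∀ i, e i ∈ F) → ¬ HasTree e D Set.univ := by
  by_contra! hcon
  refine h.ne (ENat.eq_top_iff_forall_ge.2 fun D => ?_)
  obtain ⟨I, e, he, hD⟩ := hcon D
  obtain ⟨x, hx⟩ := hD.exists_tree
  refine le_iSup₂_of_le (f := fun (n : ℕ) (_ : ∃ x : Tree X n, Shatters F x) => (n : ℕ∞)) D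
    ⟨x, fun ε => ?_⟩ le_rfl
  obtain ⟨i, -, hi⟩ := hx ε
  exact ⟨e i, he i, hi⟩

theorem Shatters.restrict {m n : ℕ} (hnm : n ≤ m) {x : Tree X m} (hx : Shatters F x) :
    ∃ y : Tree X n, Shatters F y := by
  refine ⟨fun t => x (Fin.castLE hnm t), fun ε => ?_⟩
  -- Signs beyond depth `n` do not affect the truncated tree, so any extension works.
  obtain ⟨f, hf, h⟩ := hx fun t => if ht : t.1 < n then ε ⟨t, ht⟩ else true
  refine ⟨f, hf, fun t => ?_⟩
  have := h (Fin.castLE hnm t)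
  simp only [Fin.val_castLE, Fin.is_lt, dif_pos, Fin.eta] at this
  rw [← this]
  congr 2
  ext i
  simp only [past, Fin.val_castLE]
  rw [dif_pos (lt_of_lt_of_le i.2 t.2.le)]
  rfl

theorem exists_shatters_of_not_lt_top (h : ¬ ldim F < ⊤) (n : ℕ) :
    ∃ x : Tree X n, Shatters F x := by
  by_contra hcon
  refine h (lt_of_le_of_lt (iSup₂_le fun m hm => ?_) (ENat.natCast_lt_top n))
  obtain ⟨x, hx⟩ := hm
  rcases le_total n m with hnm | hmn
  · exact absurd (hx.restrict hnm) hcon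
  · exact_mod_cast hmn

end Ldim

/-! ### Sequential Rademacher complexity -/

section Rademacher

variable {X : Type*} {F : Set (X → Bool)}

/-- The mean over uniform signs of the supremum over the class of `S` plus the signed sum along
the tree. -/
def treeMean {n : ℕ} (x : Tree X n) (S : F → ℝ) : ℝ :=
  (∑ ε : Fin n → Bool, ⨆ f : F, (S f + ∑ t, sgn (ε t) * sgn (f.1 (x t (past ε t))))) / 2 ^ n

/-- Conditioning on the first sign exhibits the tree as one round of the game at its root, followed
by one of its two subtrees. -/
theorem treeMean_succ {n : ℕ} (x : Tree X (n + 1)) (S : F → ℝ) :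
    treeMean x S =
      (treeMean (fun t η => x t.succ (Fin.cons true η))
          (S + gain (fun f : F => f.1) (x 0 Fin.elim0, true)) +
        treeMean (fun t η => x t.succ (Fin.cons false η))
          (S - gain (fun f : F => f.1) (x 0 Fin.elim0, true))) / 2 := by
  have hpast : ∀ (b : Bool) (ε : Fin n → Bool) (t : Fin n),
      past (Fin.cons b ε : Fin (n + 1) → Bool) t.succ =
        (Fin.cons b (past ε t) : Fin (t + 1) → Bool) := fun b ε t => by
    ext i
    refine Fin.cases rfl (fun i => rfl) i
  have h0 : ∀ η : Fin 0 → Bool, η = Fin.elim0 := fun η => Subsingleton.elim _ _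
  have key : ∀ (b : Bool) (ε : Fin n → Bool) (f : F),
      S f + ∑ t, sgn ((Fin.cons b ε : Fin (n + 1) → Bool) t) *
          sgn (f.1 (x t (past (Fin.cons b ε : Fin (n + 1) → Bool) t))) =
        (S f + sgn b * sgn (f.1 (x 0 Fin.elim0))) + ∑ t, sgn (ε t) *
          sgn (f.1 (x t.succ (Fin.cons b (past ε t)))) := fun b ε f => by
    rw [Fin.sum_univ_succ]
    simp only [Fin.cons_zero, Fin.cons_succ, hpast]
    rw [h0 (past (Fin.cons b ε : Fin (n + 1) → Bool) 0)]
    ring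
  have hsum : ∀ G : (Fin (n + 1) → Bool) → ℝ,
      ∑ ε, G ε = ∑ ε, G (Fin.cons true ε) + ∑ ε, G (Fin.cons false ε) := fun G => by
    rw [← (Fin.consEquiv fun _ => Bool).sum_comp, Fintype.sum_prod_type, Fintype.sum_bool]
    rfl
  unfold treeMean
  rw [hsum]
  simp only [key]
  simp only [Pi.add_apply, Pi.sub_apply, gain, sgn, if_true, Bool.false_eq_true, if_false, one_mul,
    neg_mul, ← sub_eq_add_neg]
  rw [pow_succ]
  field_simp

theorem treeMean_le_pot [Nonempty X] [Nonempty F] {n : ℕ} (x : Tree X n) {S : F → ℝ}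
    (hS : FunBdd S) : treeMean x S ≤ pot (gain fun f : F => f.1) supT n S := by
  induction n generalizing S with
  | zero => simp [treeMean, pot, supT]
  | succ n ih =>
    have hz : FunBdd (gain (fun f : F => f.1) (x 0 Fin.elim0, true)) :=
      FunBdd.of_abs_le_one abs_gain_le
    rw [treeMean_succ]
    have h1 := ih (fun t η => x t.succ (Fin.cons true η)) (hS.add hz)
    have h2 := ih (fun t η => x t.succ (Fin.cons false η)) (hS.sub hz)
    have h3 := le_pot_succ (g := gain fun f : F => f.1) abs_gain_le unifBdd_supT n hS
      (x 0 Fin.elim0, true)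
    linarith

/-- The signed sum of a fixed function has mean zero along a tree. With `S = 0` this makes the
Rademacher complexity nonnegative. -/
theorem le_treeMean {n : ℕ} (x : Tree X n) {S : F → ℝ} (hS : FunBdd S) (f : F) :
    S f ≤ treeMean x S := by
  induction n generalizing S with
  | zero => simpa [treeMean] using le_ciSup hS.bddAbove f
  | succ n ih =>
    have hz : FunBdd (gain (fun f : F => f.1) (x 0 Fin.elim0, true)) :=
      FunBdd.of_abs_le_one abs_gain_le
    rw [treeMean_succ]
    have h1 := ih (fun t η => x t.succ (Fin.cons true η)) (hS.add hz)
    have h2 := ih (fun t η => x t.succ (Fin.cons false η)) (hS.sub hz)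
    simp only [Pi.add_apply, Pi.sub_apply] at h1 h2
    linarith

theorem seqRadTree_eq {n : ℕ} (x : Tree X n) :
    seqRadTree F x = 1 / n * treeMean x (0 : F → ℝ) := by
  unfold seqRadTree treeMean
  simp only [Pi.zero_apply, zero_add]
  rw [← mul_div_assoc, Finset.mul_sum]
  congr 1
  exact Finset.sum_congr rfl fun ε _ => (Real.mul_iSup_of_nonneg (by positivity) _).symm

theorem seqRad_nonneg (hF : F.Nonempty) (n : ℕ) : 0 ≤ seqRad F n := by
  obtain ⟨f, hf⟩ := hF
  refine Real.iSup_nonneg fun x => ?_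
  rw [seqRadTree_eq]
  have := le_treeMean x (S := (0 : F → ℝ)) (FunBdd.const 0) ⟨f, hf⟩
  exact mul_nonneg (by positivity) this

theorem signedAverage_le_one {n : ℕ} (x : Tree X n) (ε : Fin n → Bool) (f : X → Bool) :
    1 / (n : ℝ) * ∑ t, sgn (ε t) * sgn (f (x t (past ε t))) ≤ 1 := by
  have h : ∑ t, sgn (ε t) * sgn (f (x t (past ε t))) ≤ n := by
    refine (Finset.sum_le_sum (g := fun _ => (1 : ℝ)) fun t _ => ?_).trans (by simp)
    refine (le_abs_self _).trans ?_
    rw [abs_mul, abs_sgn, abs_sgn, one_mul]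
  rw [one_div_mul_eq_div]
  exact div_le_one_of_le₀ h (by positivity)

theorem seqRadTree_le_one {n : ℕ} (x : Tree X n) : seqRadTree F x ≤ 1 := by
  unfold seqRadTree
  rw [div_le_one (by positivity)]
  refine (Finset.sum_le_sum (g := fun _ => (1 : ℝ)) fun ε _ => ?_).trans (by simp)
  exact Real.iSup_le (fun f => signedAverage_le_one x ε f.1) zero_le_one

theorem limsup_seqRad_of_ldim (hF : F.Nonempty) (h : ldim F < ⊤) :
    limsup (fun n => seqRad F n) atTop = 0 := by
  have : Nonempty F := hF.to_subtype
  obtain ⟨D, hD⟩ := exists_not_hasTree h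
  refine limsup_eq_zero_of_eventually (Eventually.of_forall (seqRad_nonneg hF)) fun ε hε => ?_
  filter_upwards [eventually_potBound_le D hε, eventually_ge_atTop 1] with n hn hn1
  refine Real.iSup_le (fun x => ?_) hε.le
  have : Nonempty X := ⟨x ⟨0, hn1⟩ Fin.elim0⟩
  have hn0 : (0 : ℝ) < n := by exact_mod_cast hn1
  have h1 := treeMean_le_pot x (S := (0 : F → ℝ)) (FunBdd.const 0)
  have h2 := pot_supT_le (hD (fun f : F => f.1) fun f => f.2) hε n
  rw [seqRadTree_eq, one_div_mul_eq_div, div_le_iff₀ hn0]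
  linarith

/-- On a shattered tree every sign sequence is reproduced exactly by some function, so the
normalized correlation reaches one on every path. -/
theorem ldim_of_limsup_seqRad (h : limsup (fun n => seqRad F n) atTop = 0) : ldim F < ⊤ := by
  by_contra hcon
  refine limsup_ne_zero_of_eventually (c := 1) (C := 1) one_pos
    (Eventually.of_forall fun n => Real.iSup_le seqRadTree_le_one zero_le_one) ?_ h
  filter_upwards [eventually_ge_atTop 1] with n hn
  have hn0 : (0 : ℝ) < n := by exact_mod_cast hn
  obtain ⟨x, hx⟩ := exists_shatters_of_not_lt_top hcon n
  refine le_trans ?_ (le_ciSup ⟨1, by rintro _ ⟨x, rfl⟩; exact seqRadTree_le_one x⟩ x)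
  unfold seqRadTree
  rw [one_le_div (by positivity)]
  refine le_trans (by simp) (Finset.sum_le_sum (f := fun _ => (1 : ℝ)) fun ε _ => ?_)
  obtain ⟨f, hf, h⟩ := hx ε
  refine le_trans ?_
    (le_ciSup ⟨1, by rintro _ ⟨f, rfl⟩; exact signedAverage_le_one x ε f.1⟩ ⟨f, hf⟩)
  simp only [h]
  have hone : ∀ b : Bool, sgn b * sgn b = 1 := fun b => by cases b <;> simp [sgn]
  simp [hone, hn0.ne']

end Rademacher


/-- A relation `R u c`, saying that `c` bounds `u` from above in the mean, that is additive,
positively homogeneous and compatible with constant bounds yields means that respect it. -/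
theorem exists_isMean_of_rel {W : Type*} (R : (W → ℝ) → ℝ → Prop)
    (hadd : ∀ u v c d, R u c → R v d → R (u + v) (c + d))
    (hsmul : ∀ (a : ℝ) u c, 0 < a → R u c → R (a • u) (a * c))
    (hle : ∀ u c, (∀ w, u w ≤ c) → R u c)
    (hge : ∀ u b c, (∀ w, b ≤ u w) → R u c → b ≤ c) (u₀ : W → ℝ) (hu₀ : FunBdd u₀) :
    ∃ μ, IsMean μ ∧ (∀ u c, FunBdd u → R u c → μ u ≤ c) ∧ μ u₀ = sInf {c | R u₀ c} := by
  have hbelow : ∀ u, FunBdd u → BddBelow {c | R u c} := fun u hu => by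
    obtain ⟨C, hC⟩ := hu
    exact ⟨-C, fun c hc => hge u _ c (fun w => (abs_le.1 (hC w)).1) hc⟩
  have hne : ∀ u, FunBdd u → {c | R u c}.Nonempty := fun u hu => by
    obtain ⟨C, hC⟩ := hu
    exact ⟨C, hle u C fun w => (abs_le.1 (hC w)).2⟩
  have hmul : ∀ (a : ℝ) u, 0 < a → FunBdd u →
      sInf {c | R (a • u) c} ≤ a * sInf {c | R u c} := fun a u ha hu => by
    rw [← div_le_iff₀' ha]
    refine le_csInf (hne u hu) fun c hc => ?_
    rw [div_le_iff₀' ha]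
    exact csInf_le (hbelow _ (hu.smul a)) (hsmul a u c ha hc)
  obtain ⟨μ, hμ, hμN, hμ₀⟩ := exists_isMean_le (fun u => sInf {c | R u c}) (fun a ha u hu => by
      refine le_antisymm (hmul a u ha hu) ?_
      have h := hmul a⁻¹ (a • u) (inv_pos.2 ha) (hu.smul a)
      rwa [inv_smul_smul₀ ha.ne', ← div_eq_inv_mul, le_div_iff₀' ha] at h)
    (fun u v hu hv => by
      have h1 : ∀ c ∈ {c | R u c}, ∀ d ∈ {d | R v d}, sInf {c | R (u + v) c} ≤ c + d :=
        fun c hc d hd => csInf_le (hbelow _ (hu.add hv)) (hadd u v c d hc hd)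
      have h2 : ∀ c ∈ {c | R u c}, sInf {c | R (u + v) c} - c ≤ sInf {d | R v d} := fun c hc =>
        le_csInf (hne v hv) fun d hd => by linarith [h1 c hc d hd]
      have h3 : sInf {c | R (u + v) c} - sInf {d | R v d} ≤ sInf {c | R u c} :=
        le_csInf (hne u hu) fun c hc => by linarith [h2 c hc]
      linarith)
    (fun u c hu h => csInf_le (hbelow u hu) (hle u c h)) u₀ hu₀
  exact ⟨μ, hμ, fun u c hu hc => (hμN u hu).trans (csInf_le (hbelow u hu) hc), hμ₀⟩

/-! ### Mixed strategies with finite support -/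

section Online

variable {X : Type*} {F : Set (X → Bool)}

theorem loss_eq (z : X × Bool) (f : X → Bool) : loss z f = (1 - sgn z.2 * sgn (f z.1)) / 2 := by
  obtain ⟨x, y⟩ := z
  unfold loss
  cases hf : f x <;> cases y <;> simp [sgn]

theorem loss_nonneg (z : X × Bool) (f : X → Bool) : 0 ≤ loss z f := by
  unfold loss
  split_ifs <;> norm_num

theorem loss_le_one (z : X × Bool) (f : X → Bool) : loss z f ≤ 1 := by
  unfold loss
  split_ifs <;> norm_num

theorem abs_loss_le (z : X × Bool) (f : X → Bool) : |loss z f| ≤ 1 := by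
  rw [abs_of_nonneg (loss_nonneg z f)]
  exact loss_le_one z f

/-- Weights of a probability distribution with finite support on `F`. -/
def IsWeight (q : F →₀ ℝ) : Prop := (∀ f, 0 ≤ q f) ∧ q.sum (fun _ a => a) = 1

/-- The minimax theorem for one round of the online game, with a continuation given by the
potential. -/
theorem exists_isWeight_le [Nonempty X] [Nonempty F] (k : ℕ) {S : F → ℝ} (hS : FunBdd S) {δ : ℝ}
    (hδ : 0 < δ) : ∃ q : F →₀ ℝ, IsWeight q ∧ ∀ z : X × Bool,
      q.sum (fun f a => a * loss z f.1) +
        pot (gain fun f : F => f.1) supT k (fun f => S f - loss z f.1) ≤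
      pot (gain fun f : F => f.1) supT (k + 1) S + δ := by
  -- If every mixed prediction is beaten by some `z`, no payoff `h r` with `r ≥ 0` lies below a
  -- negative constant. Hahn-Banach then yields a mean nonnegative on all these payoffs: a mixed
  -- strategy of the adversary that beats every single function.
  by_contra! hcon
  set g : X × Bool → F → ℝ := gain fun f : F => f.1 with hg
  have hg1 : ∀ z i, |g z i| ≤ 1 := abs_gain_le
  set v := pot g supT (k + 1) S + δ with hv
  set C : X × Bool → ℝ := fun z => pot g supT k (fun f => S f - loss z f.1) with hC
  let h : (F →₀ ℝ) → X × Bool → ℝ := fun r z => r.sum fun f a => a * (loss z f.1 + C z - v)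
  have hadd : ∀ r s z, h (r + s) z = h r z + h s z := fun r s z =>
    Finsupp.sum_add_index' (by simp) (by intros; ring)
  have hsmul : ∀ (a : ℝ) r z, h (a • r) z = a * h r z := fun a r z => by
    change (a • r).sum _ = a * r.sum _
    rw [Finsupp.sum_smul_index (by simp), Finsupp.mul_sum]
    exact Finsupp.sum_congr fun _ _ => by ring
  have hexpand : ∀ r z, h r z =
      r.sum (fun f a => a * loss z f.1) + r.sum (fun _ a => a) * (C z - v) := fun r z => by
    change r.sum _ = _
    rw [Finsupp.sum_mul, ← Finsupp.sum_add]
    exact Finsupp.sum_congr fun _ _ => by ring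
  have hpos : ∀ r : F →₀ ℝ, (∀ f, 0 ≤ r f) → ∀ c, (∀ z, h r z ≤ c) → 0 ≤ c := by
    intro r hr c hc
    set m := r.sum (fun _ a => a) with hm
    have hm0 : 0 ≤ m := Finset.sum_nonneg fun f _ => hr f
    rcases hm0.eq_or_lt with hm0 | hm0
    · obtain ⟨x⟩ := ‹Nonempty X›
      have h1 := hc (x, true)
      rw [hexpand, ← hm, ← hm0] at h1
      have h2 : 0 ≤ r.sum (fun f a => a * loss (x, true) f.1) :=
        Finset.sum_nonneg fun f _ => mul_nonneg (hr f) (loss_nonneg _ _)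
      linarith
    · have hq : IsWeight (m⁻¹ • r) := by
        refine ⟨fun f => mul_nonneg (inv_nonneg.2 hm0.le) (hr f), ?_⟩
        rw [Finsupp.sum_smul_index (by simp), ← Finsupp.mul_sum, ← hm, inv_mul_cancel₀ hm0.ne']
      obtain ⟨z, hz⟩ := hcon _ hq
      have h1 := hexpand (m⁻¹ • r) z
      rw [hq.2, hsmul] at h1
      have h2 : 0 < m⁻¹ * h r z := by
        rw [h1]
        linarith
      exact (pos_of_mul_pos_right h2 (inv_nonneg.2 hm0.le)).le.trans (hc z)
  obtain ⟨μ, hμ, hμR, -⟩ := exists_isMean_of_rel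
    (fun u c => ∃ r : F →₀ ℝ, (∀ f, 0 ≤ r f) ∧ ∀ z, u z + h r z ≤ c)
    (by
      rintro u w c d ⟨r, hr, hrc⟩ ⟨s, hs, hsd⟩
      refine ⟨r + s, fun f => add_nonneg (hr f) (hs f), fun z => ?_⟩
      rw [hadd, Pi.add_apply]
      linarith [hrc z, hsd z])
    (by
      rintro a u c ha ⟨r, hr, hrc⟩
      refine ⟨a • r, fun f => mul_nonneg ha.le (hr f), fun z => ?_⟩
      rw [hsmul, Pi.smul_apply, smul_eq_mul, ← mul_add]
      exact mul_le_mul_of_nonneg_left (hrc z) ha.le)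
    (fun u c huc => ⟨0, fun f => le_rfl, fun z => by simpa [h] using huc z⟩)
    (by
      rintro u b c hb ⟨r, hr, hrc⟩
      have := hpos r hr (c - b) fun z => by linarith [hrc z, hb z]
      linarith) (fun _ => 0) (FunBdd.const 0)
  obtain ⟨B, hB⟩ := hS
  have hS : FunBdd S := ⟨B, hB⟩
  have hSl : ∀ z : X × Bool, FunBdd fun f : F => S f - loss z f.1 := fun z =>
    hS.sub ⟨1, fun f => abs_loss_le z f.1⟩
  have hCb : FunBdd C := (unifBdd_pot hg1 unifBdd_supT k).funBdd
    ⟨B + 1, fun z f => (abs_sub _ _).trans (add_le_add (hB f) (abs_loss_le z f.1))⟩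
  have hlb : ∀ f : F, FunBdd fun z => loss z f.1 := fun f => ⟨1, fun z => abs_loss_le z f.1⟩
  have hgb : ∀ f : F, FunBdd fun z => g z f := fun f => ⟨1, fun z => hg1 z f⟩
  -- Nonnegativity of `μ` on the payoff of the pure prediction `f`, that is, the weight concentrated
  -- at `f`.
  have hlower : ∀ f : F, v - μ C ≤ μ fun z => loss z f.1 := fun f => by
    have hb := ((hlb f).add hCb).sub (FunBdd.const v)
    have h1 := hμR ((-1 : ℝ) • (((fun z => loss z f.1) + C) - fun _ => v)) 0 (hb.smul _)
      ⟨Finsupp.single f 1, fun f' => by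
        classical
        rw [Finsupp.single_apply]
        split_ifs <;> norm_num, fun z => by
        simp [h]⟩
    rw [hμ.smul _ _ hb, hμ.sub ((hlb f).add hCb) (FunBdd.const v), hμ.const,
      hμ.add _ _ (hlb f) hCb] at h1
    linarith
  have hmean : ∀ f : F, μ (fun z => loss z f.1) = 1 / 2 + (-1 / 2) * μ fun z => g z f := fun f => by
    rw [← hμ.smul _ _ (hgb f), ← hμ.const_add _ ((hgb f).smul _)]
    congr 1
    ext z
    simp only [loss_eq, hg, gain, Pi.smul_apply, smul_eq_mul]
    ring
  have hsym := pot_symmetrization hg1 unifBdd_supT hμ (jensen_supT hμ)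
    (jensen_supT isMean_boolMean) k id hS
  simp only [id] at hsym
  have hcb : ∃ D, ∀ z f, |S f + (g z f - μ fun z' => g z' f) / 2| ≤ D := by
    refine ⟨B + 1, fun z f => (abs_add_le _ _).trans (add_le_add (hB f) ?_)⟩
    have h1 := abs_le.1 (hg1 z f)
    have h2 := abs_le.1 (hμ.abs_le (u := fun z' => g z' f) fun z' => hg1 z' f)
    rw [abs_le]
    constructor <;> linarith [h1.1, h1.2, h2.1, h2.2]
  -- By `hlower` the constant can be absorbed into the vector as the mean loss, which turns the
  -- uncentred step into a centred one. Averaging and symmetrizing then give `v ≤ v - δ`.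
  have hstep : ∀ z, (v - μ C) + C z ≤
      pot g supT k (fun f => S f + (g z f - μ fun z' => g z' f) / 2) := fun z => by
    rw [add_comm]
    refine pot_add_le hg1 unifBdd_supT (fun _ _ _ _ hS' h => supT_add_le hS' h) k (hSl z)
      (hcb.imp fun D hD => hD z) fun f => ?_
    have h1 := hlower f
    rw [hmean f] at h1
    have h2 : loss z f.1 = (1 - g z f) / 2 := loss_eq z f.1
    linarith
  have hfin := hμ.mono _ _ ((FunBdd.const (v - μ C)).add hCb)
    ((unifBdd_pot hg1 unifBdd_supT k).funBdd hcb) hstep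
  rw [hμ.add _ _ (FunBdd.const _) hCb, hμ.const] at hfin
  linarith

theorem measurable_loss_left (z : X × Bool) : Measurable fun f : F => loss z f.1 := by
  have h1 : Measurable fun f : F => f.1 z.1 := (measurable_pi_apply z.1).comp measurable_subtype_coe
  exact (measurable_of_finite fun b : Bool => if b ≠ z.2 then (1 : ℝ) else 0).comp h1

theorem exists_probabilityMeasure {q : F →₀ ℝ} (hq : IsWeight q) :
    ∃ Q : ProbabilityMeasure F, ∀ z, randLoss z Q = q.sum fun f a => a * loss z f.1 := by
  let m : Measure F := ∑ f ∈ q.support, ENNReal.ofReal (q f) • Measure.dirac f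
  have hm : IsProbabilityMeasure m := by
    constructor
    simp only [m, Measure.coe_finsetSum, Finset.sum_apply, Measure.smul_apply,
      measure_univ, smul_eq_mul, mul_one]
    rw [← ENNReal.ofReal_sum_of_nonneg fun f _ => hq.1 f, ← ENNReal.ofReal_one]
    congr 1
    exact hq.2
  refine ⟨⟨m, hm⟩, fun z => ?_⟩
  have hmeas := (measurable_loss_left (F := F) z).stronglyMeasurable
  change ∫ f, loss z f.1 ∂m = _
  rw [integral_finsetSum_measure]
  · refine Finset.sum_congr rfl fun f _ => ?_
    rw [integral_smul_measure, integral_dirac' _ _ hmeas, ENNReal.toReal_ofReal (hq.1 f),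
      smul_eq_mul]
  · intro f _
    refine Integrable.smul_measure ?_ ENNReal.ofReal_ne_top
    exact Integrable.of_bound hmeas.aestronglyMeasurable 1
      (Eventually.of_forall fun f => abs_loss_le z f.1)

/-- The law `Q` on `F` acts as a distribution with finite support. -/
def FiniteLaw (Q : ProbabilityMeasure F) : Prop :=
  ∃ q : F →₀ ℝ, IsWeight q ∧ ∀ z, randLoss z Q = q.sum fun f a => a * loss z f.1

/-- Rules with finitely supported laws whose regret is bounded by the potential. -/
theorem exists_rules [Nonempty X] [Nonempty F] (n : ℕ) {δ : ℝ} (hδ : 0 < δ) :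
    ∃ A : Rules F, (∀ t h, FiniteLaw (A t h)) ∧ ∀ z : Fin n → X × Bool,
      ∑ t, randLoss (z t) (A t (past z t)) ≤
        (⨅ f : F, ∑ t, loss (z t) f.1) + pot (gain fun f : F => f.1) supT n 0 + n * δ := by
  have hex : ∀ (k : ℕ) (S : F → ℝ), ∃ Q : ProbabilityMeasure F, FiniteLaw Q ∧
      (FunBdd S → ∀ z, randLoss z Q +
        pot (gain fun f : F => f.1) supT k (fun f => S f - loss z f.1) ≤
        pot (gain fun f : F => f.1) supT (k + 1) S + δ) := fun k S => by
    by_cases hS : FunBdd S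
    · obtain ⟨q, hq, h⟩ := exists_isWeight_le k hS hδ
      obtain ⟨Q, hQ⟩ := exists_probabilityMeasure hq
      exact ⟨Q, ⟨q, hq, hQ⟩, fun _ z => by rw [hQ]; exact h z⟩
    -- Unbounded vectors never occur in play; the default law must still be finitely supported for
    -- later measurability.
    · obtain ⟨q, hq, -⟩ := exists_isWeight_le (F := F) k (FunBdd.const 0) hδ
      obtain ⟨Q, hQ⟩ := exists_probabilityMeasure hq
      exact ⟨Q, ⟨q, hq, hQ⟩, fun h => absurd h hS⟩
  choose Q hQ1 hQ2 using hex
  -- The state is minus the cumulative loss, and `n - 1 - t` rounds remain after the current one.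
  let A : Rules F := fun t h => Q (n - 1 - t) fun f => -∑ i, loss (h i) f.1
  refine ⟨A, fun t h => hQ1 _ _, ?_⟩
  have hSb : ∀ {m : ℕ} (z : Fin m → X × Bool), FunBdd fun f : F => -∑ i, loss (z i) f.1 :=
    fun {m} z => ⟨m, fun f => by
      rw [abs_neg]
      refine (Finset.abs_sum_le_sum_abs _ _).trans ?_
      refine (Finset.sum_le_sum fun i _ => abs_loss_le (z i) f.1).trans (by simp)⟩
  -- Loss so far plus remaining potential grows by at most `δ` per round. At the end the potential
  -- is minus the best cumulative loss in the class.
  have key : ∀ m ≤ n, ∀ z : Fin m → X × Bool, ∑ t, randLoss (z t) (A t (past z t)) +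
      pot (gain fun f : F => f.1) supT (n - m) (fun f => -∑ i, loss (z i) f.1) ≤
      pot (gain fun f : F => f.1) supT n 0 + m * δ := by
    intro m
    induction m with
    | zero =>
      intro _ z
      simp only [Finset.univ_eq_empty, Finset.sum_empty, neg_zero, zero_add, Nat.sub_zero,
        Nat.cast_zero, zero_mul, add_zero]
      exact le_rfl
    | succ m ih =>
      intro hm z
      have h1 := ih (by omega) (Fin.init z)
      have h2 := hQ2 (n - 1 - m) (fun f => -∑ i, loss (Fin.init z i) f.1) (hSb _) (z (Fin.last m))
      have e1 : n - 1 - m + 1 = n - m := by omega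
      have e2 : n - 1 - m = n - (m + 1) := by omega
      rw [e1] at h2
      have e3 : (fun f : F => -∑ i, loss (z i) f.1) =
          fun f : F => -∑ i, loss (Fin.init z i) f.1 - loss (z (Fin.last m)) f.1 := by
        ext f
        rw [Fin.sum_univ_castSucc]
        simp only [Fin.init]
        ring
      have e4 : ∑ t, randLoss (z t) (A t (past z t)) =
          ∑ t, randLoss (Fin.init z t) (A t (past (Fin.init z) t)) +
          randLoss (z (Fin.last m)) (Q (n - 1 - m) fun f => -∑ i, loss (Fin.init z i) f.1) := by
        rw [Fin.sum_univ_castSucc]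
        rfl
      rw [e3, e4, ← e2]
      push_cast
      linarith
  intro z
  have h := key n le_rfl z
  rw [Nat.sub_self] at h
  have h1 : -supT (fun f : F => -∑ i, loss (z i) f.1) ≤ ⨅ f : F, ∑ t, loss (z t) f.1 :=
    le_ciInf fun f => by
      have : -∑ i, loss (z i) f.1 ≤ supT fun f : F => -∑ i, loss (z i) f.1 :=
        le_ciSup (hSb z).bddAbove f
      linarith
  simp only [pot] at h
  linarith

end Online


/-! ### Paths of trees that defeat a learning rule -/

section Paths

variable {X : Type*} {F : Set (X → Bool)}

theorem integrable_loss (z : X × Bool) (Q : ProbabilityMeasure F) :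
    Integrable (fun f : F => loss z f.1) (Q : Measure F) :=
  Integrable.of_bound (measurable_loss_left z).aestronglyMeasurable 1
    (Eventually.of_forall fun f => abs_loss_le z f.1)

theorem randLoss_nonneg (z : X × Bool) (Q : ProbabilityMeasure F) : 0 ≤ randLoss z Q :=
  integral_nonneg fun f => loss_nonneg z f.1

theorem randLoss_le_one (z : X × Bool) (Q : ProbabilityMeasure F) : randLoss z Q ≤ 1 := by
  have := integral_mono (integrable_loss z Q) (integrable_const 1) fun f => loss_le_one z f.1
  simpa [randLoss] using this

theorem abs_randLoss_le (z : X × Bool) (Q : ProbabilityMeasure F) : |randLoss z Q| ≤ 1 := by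
  rw [abs_of_nonneg (randLoss_nonneg z Q)]
  exact randLoss_le_one z Q

theorem randLoss_true_add_false (x : X) (Q : ProbabilityMeasure F) :
    randLoss (x, true) Q + randLoss (x, false) Q = 1 := by
  unfold randLoss
  rw [← integral_add (integrable_loss _ Q) (integrable_loss _ Q)]
  have : ∀ f : F, loss (x, true) f.1 + loss (x, false) f.1 = 1 := fun f => by
    simp only [loss]
    cases f.1 x <;> simp
  simp [this]

/-- The labelled sequence read along the path `ε` of the tree `x`. -/
def pathOf {n : ℕ} (x : Tree X n) (ε : Fin n → Bool) : Fin n → X × Bool :=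
  fun t => (x t (past ε t), ε t)

theorem past_snoc_castSucc {α : Type*} {n : ℕ} (z : Fin n → α) (a : α) (t : Fin n) :
    past (Fin.snoc z a : Fin (n + 1) → α) t.castSucc = past z t := by
  ext i
  exact Fin.snoc_castSucc (α := fun _ => α) a z (Fin.castLE t.isLt.le i)

theorem past_snoc_last {α : Type*} {n : ℕ} (z : Fin n → α) (a : α) :
    past (Fin.snoc z a : Fin (n + 1) → α) (Fin.last n) = z := by
  ext i
  exact Fin.snoc_castSucc (α := fun _ => α) a z i

theorem pathOf_snoc {n : ℕ} (x : Tree X (n + 1)) (ε : Fin n → Bool) (b : Bool) :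
    pathOf x (Fin.snoc ε b) =
      Fin.snoc (pathOf (fun t => x t.castSucc) ε) (x (Fin.last n) ε, b) := by
  ext1 t
  refine Fin.lastCases ?_ (fun t => ?_) t
  · rw [Fin.snoc_last]
    simp only [pathOf, past_snoc_last, Fin.snoc_last]
  · rw [Fin.snoc_castSucc]
    simp only [pathOf, past_snoc_castSucc, Fin.snoc_castSucc]

/-- On every tree there is a path along which the rules err with probability at least `1/2`. -/
theorem exists_path_half_le (A : Rules F) {n : ℕ} (x : Tree X n) : ∃ ε : Fin n → Bool,
    ∀ t, 1 / 2 ≤ randLoss (pathOf x ε t) (A t (past (pathOf x ε) t)) := by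
  induction n with
  | zero => exact ⟨Fin.elim0, fun t => t.elim0⟩
  | succ n ih =>
    obtain ⟨ε, hε⟩ := ih fun t => x t.castSucc
    obtain ⟨b, hb⟩ : ∃ b, 1 / 2 ≤ randLoss (x (Fin.last n) ε, b)
        (A n (pathOf (fun t => x t.castSucc) ε)) := by
      have := randLoss_true_add_false (x (Fin.last n) ε) (A n (pathOf (fun t => x t.castSucc) ε))
      by_contra! h
      linarith [h true, h false]
    refine ⟨Fin.snoc ε b, fun t => ?_⟩
    rw [pathOf_snoc]
    refine Fin.lastCases ?_ (fun t => ?_) t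
    · rw [Fin.snoc_last, past_snoc_last]
      exact hb
    · rw [Fin.snoc_castSucc, past_snoc_castSucc]
      exact hε t

theorem half_le_average {n : ℕ} (hn : 1 ≤ n) {u : Fin n → ℝ} (hu : ∀ t, 1 / 2 ≤ u t) :
    1 / 2 ≤ 1 / (n : ℝ) * ∑ t, u t := by
  have hn0 : (0 : ℝ) < n := by exact_mod_cast hn
  have h := Finset.sum_le_sum fun t (_ : t ∈ Finset.univ) => hu t
  rw [Finset.sum_const, Finset.card_univ, Fintype.card_fin, nsmul_eq_mul] at h
  rw [one_div_mul_eq_div, le_div_iff₀ hn0]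
  linarith

theorem average_le_one {n : ℕ} {u : Fin n → ℝ} (hu : ∀ t, u t ≤ 1) :
    1 / (n : ℝ) * ∑ t, u t ≤ 1 := by
  have h := Finset.sum_le_sum fun t (_ : t ∈ Finset.univ) => hu t
  rw [Finset.sum_const, Finset.card_univ, Fintype.card_fin, nsmul_eq_mul, mul_one] at h
  rw [one_div_mul_eq_div]
  exact div_le_one_of_le₀ h (by positivity)

end Paths

/-! ### Online learnability -/

section OnlineLearnable

variable {X : Type*} {F : Set (X → Bool)}

theorem onlineRegret_le_one (A : Rules F) {n : ℕ} (z : Fin n → X × Bool) :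
    onlineRegret A z ≤ 1 := by
  have h1 : 0 ≤ ⨅ f : F, ∑ t, loss (z t) f.1 :=
    Real.iInf_nonneg fun f => Finset.sum_nonneg fun t _ => loss_nonneg _ _
  refine le_trans ?_ (average_le_one fun t => randLoss_le_one (z t) (A t (past z t)))
  exact mul_le_mul_of_nonneg_left (by linarith) (by positivity)

/-- A function that labels the sequence perfectly makes the comparator vanish, so the regret is the
whole loss of the rule. -/
theorem average_le_iSup_onlineRegret (A : Rules F) {n : ℕ} {z : Fin n → X × Bool} {f : X → Bool}
    (hf : f ∈ F) (hz : ∀ t, f (z t).1 = (z t).2) :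
    1 / (n : ℝ) * ∑ t, randLoss (z t) (A t (past z t)) ≤
      ⨆ z : Fin n → X × Bool, onlineRegret A z := by
  refine le_trans ?_ (le_ciSup ⟨1, by rintro _ ⟨z, rfl⟩; exact onlineRegret_le_one A z⟩ z)
  refine mul_le_mul_of_nonneg_left ?_ (by positivity)
  have h : ⨅ f : F, ∑ t, loss (z t) f.1 ≤ ∑ t, loss (z t) f :=
    ciInf_le ⟨0, by rintro _ ⟨f, rfl⟩; exact Finset.sum_nonneg fun t _ => loss_nonneg _ _⟩
      (⟨f, hf⟩ : F)
  simp only [loss, hz, ne_eq, not_true_eq_false, if_false, Finset.sum_const_zero] at h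
  simp only [loss]
  linarith

theorem iSup_onlineRegret_nonneg (hF : F.Nonempty) (A : Rules F) {n : ℕ} (hn : 1 ≤ n) :
    0 ≤ ⨆ z : Fin n → X × Bool, onlineRegret A z := by
  obtain ⟨f, hf⟩ := hF
  -- Over an empty `X` there are no sequences, and the supremum takes its default value zero.
  rcases isEmpty_or_nonempty X with hX | ⟨⟨x⟩⟩
  · have : IsEmpty (Fin n → X × Bool) := ⟨fun z => hX.elim (z ⟨0, hn⟩).1⟩
    rw [Real.iSup_of_isEmpty]
  · refine le_trans ?_ (average_le_iSup_onlineRegret A (z := fun _ => (x, f x)) hf fun _ => rfl)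
    exact mul_nonneg (by positivity) (Finset.sum_nonneg fun t _ => randLoss_nonneg _ _)

theorem nonempty_rules (hF : F.Nonempty) : Nonempty (Rules F) := by
  obtain ⟨f, hf⟩ := hF
  exact ⟨fun _ _ => ⟨Measure.dirac ⟨f, hf⟩, inferInstance⟩⟩

theorem onlineLearnable_of_ldim (hF : F.Nonempty) (h : ldim F < ⊤) : OnlineLearnable F := by
  have : Nonempty F := hF.to_subtype
  have : Nonempty (Rules F) := nonempty_rules hF
  obtain ⟨D, hD⟩ := exists_not_hasTree h
  refine limsup_eq_zero_of_eventually ?_ fun ε hε => ?_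
  · filter_upwards [eventually_ge_atTop 1] with n hn
    exact le_ciInf fun A => iSup_onlineRegret_nonneg hF A hn
  · filter_upwards [eventually_potBound_le D (half_pos hε), eventually_ge_atTop 1] with n hn hn1
    have hbelow : BddBelow (Set.range fun A : Rules F =>
        ⨆ z : Fin n → X × Bool, onlineRegret A z) :=
      ⟨0, by rintro _ ⟨A, rfl⟩; exact iSup_onlineRegret_nonneg hF A hn1⟩
    have hn0 : (0 : ℝ) < n := by exact_mod_cast hn1
    rcases isEmpty_or_nonempty X with hX | hX
    · have : IsEmpty (Fin n → X × Bool) := ⟨fun z => hX.elim (z ⟨0, hn1⟩).1⟩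
      refine (ciInf_le hbelow (Classical.arbitrary _)).trans ?_
      rw [Real.iSup_of_isEmpty]
      exact hε.le
    · obtain ⟨A, -, hA⟩ := exists_rules (F := F) n (half_pos hε)
      refine (ciInf_le hbelow A).trans (Real.iSup_le (fun z => ?_) hε.le)
      have h1 := hA z
      have h2 := pot_supT_le (hD (fun f : F => f.1) fun f => f.2) (half_pos hε) n
      rw [onlineRegret, one_div_mul_eq_div, div_le_iff₀ hn0]
      linarith

theorem ldim_of_onlineLearnable (hF : F.Nonempty) (h : OnlineLearnable F) : ldim F < ⊤ := by
  have : Nonempty (Rules F) := nonempty_rules hF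
  by_contra hcon
  refine limsup_ne_zero_of_eventually (c := 1 / 2) (C := 1) one_half_pos ?_ ?_ h
  · filter_upwards [eventually_ge_atTop 1] with n hn
    refine (ciInf_le ⟨0, by rintro _ ⟨A, rfl⟩; exact iSup_onlineRegret_nonneg hF A hn⟩
      (Classical.arbitrary _)).trans (Real.iSup_le (onlineRegret_le_one _) zero_le_one)
  · filter_upwards [eventually_ge_atTop 1] with n hn
    obtain ⟨x, hx⟩ := exists_shatters_of_not_lt_top hcon n
    refine le_ciInf fun A => ?_
    obtain ⟨ε, hε⟩ := exists_path_half_le A x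
    obtain ⟨f, hf, hfε⟩ := hx ε
    exact (half_le_average hn hε).trans (average_le_iSup_onlineRegret A hf hfε)

end OnlineLearnable

/-! ### Upper expectations -/

section UpperExp

variable {α : Type*} [MeasurableSpace α] {μ : Measure α} [IsProbabilityMeasure μ]

theorem nonempty_upperExp {h : α → ℝ} {C : ℝ} (hC : ∀ x, h x ≤ C) :
    {a : ℝ | ∃ g : α → ℝ, Measurable g ∧ Integrable g μ ∧ (∀ x, h x ≤ g x) ∧
      a = ∫ x, g x ∂μ}.Nonempty :=
  ⟨_, fun _ => C, measurable_const, integrable_const C, hC, rfl⟩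

theorem le_integral_of_le {g : α → ℝ} (hg : Integrable g μ) {b : ℝ} (hb : ∀ x, b ≤ g x) :
    b ≤ ∫ x, g x ∂μ := by
  have := integral_mono (integrable_const b) hg hb
  simpa using this

theorem upperExp_le_integral {h g : α → ℝ} (hh : FunBdd h) (hg : Measurable g)
    (hgi : Integrable g μ) (hle : ∀ x, h x ≤ g x) : upperExp μ h ≤ ∫ x, g x ∂μ := by
  obtain ⟨C, hC⟩ := hh
  refine csInf_le ⟨-C, ?_⟩ ⟨g, hg, hgi, hle, rfl⟩
  rintro _ ⟨g, -, hgi, hle, rfl⟩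
  exact le_integral_of_le hgi fun x => (abs_le.1 (hC x)).1.trans (hle x)

theorem upperExp_mono {h h' : α → ℝ} (hh : FunBdd h) (hh' : FunBdd h') (hle : ∀ x, h x ≤ h' x) :
    upperExp μ h ≤ upperExp μ h' := by
  obtain ⟨C, hC⟩ := hh'
  refine le_csInf (nonempty_upperExp fun x => (abs_le.1 (hC x)).2) ?_
  rintro _ ⟨g, hg, hgi, hle', rfl⟩
  exact upperExp_le_integral hh hg hgi fun x => (hle x).trans (hle' x)

theorem abs_upperExp_le {h : α → ℝ} {C : ℝ} (hC : ∀ x, |h x| ≤ C) : |upperExp μ h| ≤ C := by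
  refine abs_le.2 ⟨?_, ?_⟩
  · refine le_csInf (nonempty_upperExp fun x => (abs_le.1 (hC x)).2) ?_
    rintro _ ⟨g, -, hgi, hle, rfl⟩
    exact le_integral_of_le hgi fun x => (abs_le.1 (hC x)).1.trans (hle x)
  · have := upperExp_le_integral (μ := μ) (h := h) ⟨C, hC⟩ measurable_const (integrable_const C)
      fun x => (abs_le.1 (hC x)).2
    simpa using this

theorem upperExp_nonneg {h : α → ℝ} (h0 : ∀ x, 0 ≤ h x) : 0 ≤ upperExp μ h := by
  refine Real.sInf_nonneg ?_
  rintro _ ⟨g, -, hgi, hle, rfl⟩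
  exact le_integral_of_le hgi fun x => (h0 x).trans (hle x)

theorem le_upperExp_dirac {h : α → ℝ} (hh : FunBdd h) (a : α) :
    h a ≤ upperExp (Measure.dirac a) h := by
  obtain ⟨C, hC⟩ := hh
  refine le_csInf (nonempty_upperExp fun x => (abs_le.1 (hC x)).2) ?_
  rintro _ ⟨g, hg, -, hle, rfl⟩
  rw [integral_dirac' _ _ hg.stronglyMeasurable]
  exact hle a

/-- The upper expectation of a bounded function is attained at a mean that extends the integral
of bounded measurable functions. -/
theorem exists_isMean_upperExp {u₀ : α → ℝ} (hu₀ : FunBdd u₀) :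
    ∃ m : (α → ℝ) → ℝ, IsMean m ∧ m u₀ = upperExp μ u₀ ∧
      ∀ u, FunBdd u → Measurable u → m u = ∫ x, u x ∂μ := by
  obtain ⟨m, hm, hmR, hm₀⟩ := exists_isMean_of_rel
    (fun (u : α → ℝ) c => ∃ g : α → ℝ, Measurable g ∧ Integrable g μ ∧ (∀ x, u x ≤ g x) ∧
      c = ∫ x, g x ∂μ)
    (by
      rintro u v _ _ ⟨g, hg, hgi, hle, rfl⟩ ⟨g', hg', hgi', hle', rfl⟩
      exact ⟨g + g', hg.add hg', hgi.add hgi', fun x => add_le_add (hle x) (hle' x),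
        (integral_add hgi hgi').symm⟩)
    (by
      rintro a u _ ha ⟨g, hg, hgi, hle, rfl⟩
      exact ⟨a • g, hg.const_smul a, hgi.smul a,
        fun x => mul_le_mul_of_nonneg_left (hle x) ha.le, (integral_const_mul a g).symm⟩)
    (fun u c h => ⟨fun _ => c, measurable_const, integrable_const c, h, by simp⟩)
    (by
      rintro u b _ hb ⟨g, -, hgi, hle, rfl⟩
      exact le_integral_of_le hgi fun x => (hb x).trans (hle x)) u₀ hu₀
  refine ⟨m, hm, hm₀, fun u hu hum => ?_⟩
  have hui : ∀ v, FunBdd v → Measurable v → Integrable v μ := fun v ⟨C, hC⟩ hv =>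
    Integrable.of_bound hv.aestronglyMeasurable C (Eventually.of_forall hC)
  refine le_antisymm (hmR u _ hu ⟨u, hum, hui u hu hum, fun _ => le_rfl, rfl⟩) ?_
  have h1 := hmR _ _ (hu.smul (-1)) ⟨(-1 : ℝ) • u, hum.const_smul _,
    hui _ (hu.smul _) (hum.const_smul _), fun _ => le_rfl, rfl⟩
  rw [hm.smul _ _ hu] at h1
  simp only [Pi.smul_apply, smul_eq_mul, integral_const_mul] at h1
  linarith

end UpperExp


/-! ### Prequential learnability -/

section Sequences

variable {X : Type*} [MeasurableSpace X] {P : CondLaws X}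

theorem abs_upperExp_snoc_le (hP : ∀ t, IsMarkovKernel (P t)) {n : ℕ}
    {φ : (Fin (n + 1) → X × Bool) → ℝ} {C : ℝ} (hC : ∀ z, |φ z| ≤ C) (h : Fin n → X × Bool) :
    |upperExp (P n h) (fun z => φ (Fin.snoc h z))| ≤ C :=
  have := hP n
  abs_upperExp_le fun _ => hC _

theorem abs_processExp_le (hP : ∀ t, IsMarkovKernel (P t)) {n : ℕ} {φ : (Fin n → X × Bool) → ℝ}
    {C : ℝ} (hC : ∀ z, |φ z| ≤ C) : |processExp P n φ| ≤ C := by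
  induction n with
  | zero => exact hC _
  | succ n ih => exact ih fun h => abs_upperExp_snoc_le hP hC h

theorem processExp_mono (hP : ∀ t, IsMarkovKernel (P t)) {n : ℕ} {φ ψ : (Fin n → X × Bool) → ℝ}
    (hφ : FunBdd φ) (hψ : FunBdd ψ) (hle : ∀ z, φ z ≤ ψ z) :
    processExp P n φ ≤ processExp P n ψ := by
  induction n with
  | zero => exact hle _
  | succ n ih =>
    obtain ⟨C, hC⟩ := hφ
    obtain ⟨D, hD⟩ := hψ
    refine ih ⟨C, abs_upperExp_snoc_le hP hC⟩ ⟨D, abs_upperExp_snoc_le hP hD⟩ fun h => ?_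
    have := hP n
    exact upperExp_mono ⟨C, fun _ => hC _⟩ ⟨D, fun _ => hD _⟩ fun z => hle _

/-- Upper expectations of a supermartingale decrease. -/
theorem processExp_le_of_supermartingale (hP : ∀ t, IsMarkovKernel (P t))
    (Φ : (m : ℕ) → (Fin m → X × Bool) → ℝ) (hΦ : ∀ m, FunBdd (Φ m)) (n : ℕ)
    (hstep : ∀ m < n, ∀ h, upperExp (P m h) (fun z => Φ (m + 1) (Fin.snoc h z)) ≤ Φ m h) :
    processExp P n (Φ n) ≤ Φ 0 Fin.elim0 := by
  induction n with
  | zero => exact le_rfl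
  | succ n ih =>
    refine le_trans ?_ (ih fun m hm => hstep m (by omega))
    obtain ⟨C, hC⟩ := hΦ (n + 1)
    exact processExp_mono hP ⟨C, abs_upperExp_snoc_le hP hC⟩ (hΦ n) (hstep n (Nat.lt_succ_self n))

/-- The process that follows a fixed sequence. -/
def diracLaws (z : ℕ → X × Bool) : CondLaws X := fun t => Kernel.const _ (Measure.dirac (z t))

theorem isMarkovKernel_diracLaws (z : ℕ → X × Bool) (t : ℕ) :
    IsMarkovKernel (diracLaws z t) := by
  unfold diracLaws
  infer_instance

/-- A measurable majorant dominates at the point carrying the mass. Equality may fail for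
nonmeasurable `φ`, but lower bounds on the game need only this direction. -/
theorem le_processExp_diracLaws (z : ℕ → X × Bool) {n : ℕ} {φ : (Fin n → X × Bool) → ℝ}
    (hφ : FunBdd φ) : φ (fun i => z i) ≤ processExp (diracLaws z) n φ := by
  induction n with
  | zero =>
    refine le_of_eq (congrArg φ ?_)
    exact Subsingleton.elim _ _
  | succ n ih =>
    obtain ⟨C, hC⟩ := hφ
    refine le_trans ?_ (ih ⟨C, abs_upperExp_snoc_le (isMarkovKernel_diracLaws z) hC⟩)
    have h := le_upperExp_dirac (h := fun a => φ (Fin.snoc (fun i : Fin n => z i) a))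
      ⟨C, fun _ => hC _⟩ (z n)
    refine le_trans (le_of_eq (congrArg φ ?_)) h
    ext1 i
    refine Fin.lastCases ?_ (fun i => ?_) i
    · rw [Fin.snoc_last]
      rfl
    · rw [Fin.snoc_castSucc]
      rfl

end Sequences

/-! ### Conditional risks and the prequential game -/

section Risk

variable {X : Type*} [MeasurableSpace X] {F : Set (X → Bool)}

theorem measurable_loss {f : X → Bool} (hf : Measurable f) :
    Measurable fun z : X × Bool => loss z f := by
  have h : Measurable fun z : X × Bool => (f z.1, z.2) :=
    (hf.comp measurable_fst).prodMk measurable_snd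
  exact (measurable_of_finite fun p : Bool × Bool => if p.1 ≠ p.2 then (1 : ℝ) else 0).comp h

theorem risk_nonneg (P : Measure (X × Bool)) (f : X → Bool) : 0 ≤ risk P f :=
  integral_nonneg fun z => loss_nonneg z f

theorem risk_le_one (P : Measure (X × Bool)) [IsProbabilityMeasure P] (f : X → Bool) :
    risk P f ≤ 1 := by
  have h := norm_integral_le_of_norm_le_const (μ := P) (f := fun z => loss z f) (C := 1)
    (Eventually.of_forall fun z => abs_loss_le z f)
  simpa [risk] using (le_abs_self _).trans h

theorem abs_randRisk_le (P : Measure (X × Bool)) [IsProbabilityMeasure P]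
    (Q : ProbabilityMeasure F) : |randRisk P Q| ≤ 1 :=
  abs_upperExp_le fun z => abs_randLoss_le z Q

theorem randRisk_nonneg (P : Measure (X × Bool)) [IsProbabilityMeasure P]
    (Q : ProbabilityMeasure F) : 0 ≤ randRisk P Q :=
  upperExp_nonneg fun z => randLoss_nonneg z Q

theorem abs_preqRegret_le (A : Rules F) {G : Set (X → Bool)} (hG : G.Nonempty) {P : CondLaws X}
    (hP : ∀ t, IsMarkovKernel (P t)) {n : ℕ} (z : Fin n → X × Bool) :
    |preqRegret A G P z| ≤ 1 := by
  obtain ⟨f, hf⟩ := hG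
  have hprob : ∀ t : Fin n, IsProbabilityMeasure (P t (past z t)) := fun t =>
    have := hP t
    inferInstance
  have h1 : 1 / (n : ℝ) * ∑ t : Fin n, randRisk (P t (past z t)) (A t (past z t)) ≤ 1 :=
    average_le_one fun t => (abs_le.1 (abs_randRisk_le _ _)).2
  have h2 : 0 ≤ 1 / (n : ℝ) * ∑ t : Fin n, randRisk (P t (past z t)) (A t (past z t)) :=
    mul_nonneg (by positivity) (Finset.sum_nonneg fun t _ => randRisk_nonneg _ _)
  have h3 : ∀ f : G, 0 ≤ 1 / (n : ℝ) * ∑ t : Fin n, risk (P t (past z t)) f.1 := fun f =>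
    mul_nonneg (by positivity) (Finset.sum_nonneg fun t _ => risk_nonneg _ _)
  have h4 : 0 ≤ ⨅ f : G, 1 / (n : ℝ) * ∑ t : Fin n, risk (P t (past z t)) f.1 :=
    Real.iInf_nonneg h3
  have h5 : ⨅ f : G, 1 / (n : ℝ) * ∑ t : Fin n, risk (P t (past z t)) f.1 ≤ 1 :=
    (ciInf_le ⟨0, by rintro _ ⟨f, rfl⟩; exact h3 f⟩ ⟨f, hf⟩).trans
      (average_le_one fun t => risk_le_one _ _)
  unfold preqRegret
  rw [abs_le]
  constructor <;> linarith

theorem bddAbove_preqWorst (A : Rules F) (n : ℕ) :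
    BddAbove {a : ℝ | ∃ (P : CondLaws X) (G : Set (X → Bool)), (∀ t, IsMarkovKernel (P t)) ∧
      G ⊆ F ∧ G.Countable ∧ G.Nonempty ∧ a = processExp P n (fun z => preqRegret A G P z)} := by
  refine ⟨1, ?_⟩
  rintro _ ⟨P, G, hP, -, -, hG, rfl⟩
  exact (abs_le.1 (abs_processExp_le hP fun z => abs_preqRegret_le A hG hP z)).2

theorem preqWorst_le_one (A : Rules F) (n : ℕ) : preqWorst A n ≤ 1 := by
  refine Real.sSup_le ?_ zero_le_one
  rintro _ ⟨P, G, hP, -, -, hG, rfl⟩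
  exact (abs_le.1 (abs_processExp_le hP fun z => abs_preqRegret_le A hG hP z)).2

/-- Under point masses, conditional risks dominate the losses of the rule on the sequence, while the
comparator class `{f}` has risk zero. Lower bounds for individual sequences thus carry over. -/
theorem average_le_preqWorst (A : Rules F) {n : ℕ} (hn : 1 ≤ n) {z : Fin n → X × Bool}
    {f : X → Bool} (hf : f ∈ F) (hfm : Measurable f) (hz : ∀ t, f (z t).1 = (z t).2) :
    1 / (n : ℝ) * ∑ t, randLoss (z t) (A t (past z t)) ≤ preqWorst A n := by
  -- The laws after time `n` are never consulted, so the extension is arbitrary.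
  let z' : ℕ → X × Bool := fun t => if ht : t < n then z ⟨t, ht⟩ else z ⟨0, hn⟩
  have hz' : (fun i : Fin n => z' i) = z := by
    ext1 i
    simp [z']
  have hP := isMarkovKernel_diracLaws z'
  refine le_trans ?_ (le_csSup (bddAbove_preqWorst A n) ⟨diracLaws z', {f}, hP,
    Set.singleton_subset_iff.2 hf, Set.countable_singleton f, Set.singleton_nonempty f, rfl⟩)
  refine le_trans ?_ (le_processExp_diracLaws z'
    ⟨1, fun z => abs_preqRegret_le A (Set.singleton_nonempty f) hP z⟩)
  rw [hz', preqRegret]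
  have hlaw : ∀ t : Fin n, diracLaws z' t (past z t) = Measure.dirac (z t) := fun t => by
    have : z' t = z t := congrFun hz' t
    rw [← this]
    rfl
  have h1 : ∑ t, randLoss (z t) (A t (past z t)) ≤
      ∑ t : Fin n, randRisk (diracLaws z' t (past z t)) (A t (past z t)) :=
    Finset.sum_le_sum fun t _ => by
      rw [hlaw]
      exact le_upperExp_dirac ⟨1, fun z => abs_randLoss_le z _⟩ (z t)
  have h2 : ⨅ f' : ({f} : Set (X → Bool)),
      1 / (n : ℝ) * ∑ t : Fin n, risk (diracLaws z' t (past z t)) f'.1 ≤ 0 := by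
    refine (ciInf_le (Set.finite_range _).bddBelow ⟨f, rfl⟩).trans (le_of_eq ?_)
    have : ∀ t : Fin n, risk (diracLaws z' t (past z t)) f = 0 := fun t => by
      rw [hlaw, risk, integral_dirac' _ _ (measurable_loss hfm).stronglyMeasurable]
      simp [loss, hz]
    simp [this]
  have h3 := mul_le_mul_of_nonneg_left h1 (show (0 : ℝ) ≤ 1 / (n : ℝ) by positivity)
  linarith

theorem preqWorst_nonneg (hF : F.Nonempty) (hmeas : ∀ f ∈ F, Measurable f) (A : Rules F) {n : ℕ}
    (hn : 1 ≤ n) : 0 ≤ preqWorst A n := by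
  obtain ⟨f, hf⟩ := hF
  rcases isEmpty_or_nonempty X with hX | ⟨⟨x⟩⟩
  -- An empty `X` admits no Markov kernel, so the supremum runs over the empty set.
  · refine Real.sSup_nonneg ?_
    rintro _ ⟨P, G, hP, -⟩
    have := hP 0
    have h := (inferInstance : IsProbabilityMeasure (P 0 Fin.elim0)).measure_univ
    rw [Set.univ_eq_empty_iff.2 inferInstance, measure_empty] at h
    exact absurd h zero_ne_one
  · refine le_trans ?_ (average_le_preqWorst A hn (z := fun _ => (x, f x)) hf (hmeas f hf)
      fun _ => rfl)
    exact mul_nonneg (by positivity) (Finset.sum_nonneg fun t _ => randLoss_nonneg _ _)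

theorem ldim_of_prequentiallyLearnable (hF : F.Nonempty) (hmeas : ∀ f ∈ F, Measurable f)
    (h : PrequentiallyLearnable F) : ldim F < ⊤ := by
  have : Nonempty (Rules F) := nonempty_rules hF
  by_contra hcon
  refine limsup_ne_zero_of_eventually (c := 1 / 2) (C := 1) one_half_pos ?_ ?_ h
  · filter_upwards [eventually_ge_atTop 1] with n hn
    exact (ciInf_le ⟨0, by rintro _ ⟨A, rfl⟩; exact preqWorst_nonneg hF hmeas A hn⟩
      (Classical.arbitrary _)).trans (preqWorst_le_one _ n)
  · filter_upwards [eventually_ge_atTop 1] with n hn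
    obtain ⟨x, hx⟩ := exists_shatters_of_not_lt_top hcon n
    refine le_ciInf fun A => ?_
    obtain ⟨ε, hε⟩ := exists_path_half_le A x
    obtain ⟨f, hf, hfε⟩ := hx ε
    exact (half_le_average hn hε).trans (average_le_preqWorst A hn hf (hmeas f hf) hfε)

/-- A general law on `F` carries no joint measurability in point and function, but a finite mixture
is a finite sum of measurable losses. This is why the online rules were built with finite support.
-/
theorem FiniteLaw.measurable_randLoss (hmeas : ∀ f ∈ F, Measurable f) {Q : ProbabilityMeasure F}
    (hQ : FiniteLaw Q) : Measurable fun z : X × Bool => randLoss z Q := by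
  obtain ⟨q, -, hq⟩ := hQ
  simp only [hq]
  exact Finset.measurable_sum _ fun f _ => (measurable_loss (hmeas f.1 f.2)).const_mul _

/-- The potential of the prequential game after the history `h` of length `m` out of `n`. -/
def preqPot (A : Rules F) (G : Set (X → Bool)) (P : CondLaws X) (n m : ℕ)
    (h : Fin m → X × Bool) : ℝ :=
  ∑ t : Fin m, (randRisk (P t (past h t)) (A t (past h t)) - randLoss (h t) (A t (past h t))) +
    pot (gain fun f : G => f.1) supT (n - m)
      (fun f => ∑ t : Fin m, (loss (h t) f.1 - risk (P t (past h t)) f.1))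

theorem preqPot_snoc (A : Rules F) (G : Set (X → Bool)) (P : CondLaws X) (n m : ℕ)
    (h : Fin m → X × Bool) (z : X × Bool) :
    preqPot A G P n (m + 1) (Fin.snoc h z) =
      ∑ t : Fin m, (randRisk (P t (past h t)) (A t (past h t)) - randLoss (h t) (A t (past h t))) +
      (randRisk (P m h) (A m h) - randLoss z (A m h)) +
      pot (gain fun f : G => f.1) supT (n - m - 1)
        (fun f => ∑ t : Fin m, (loss (h t) f.1 - risk (P t (past h t)) f.1) +
          (loss z f.1 - risk (P m h) f.1)) := by
  have hs : ∀ φ : (t : ℕ) → (X × Bool) → (Fin t → X × Bool) → ℝ,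
      ∑ t : Fin (m + 1), φ t ((Fin.snoc h z : Fin (m + 1) → X × Bool) t)
        (past (Fin.snoc h z : Fin (m + 1) → X × Bool) t) =
      ∑ t : Fin m, φ t (h t) (past h t) + φ m z h := fun φ => by
    rw [Fin.sum_univ_castSucc, past_snoc_last, Fin.snoc_last]
    simp only [past_snoc_castSucc, Fin.snoc_castSucc]
    rfl
  unfold preqPot
  rw [hs fun t z h => randRisk (P t h) (A t h) - randLoss z (A t h), Nat.sub_sub]
  congr 2
  ext f
  exact hs fun t z h => loss z f.1 - risk (P t h) f.1

theorem abs_sum_loss_sub_risk_le {P : CondLaws X} (hP : ∀ t, IsMarkovKernel (P t)) {m : ℕ}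
    (h : Fin m → X × Bool) (f : X → Bool) :
    |∑ t : Fin m, (loss (h t) f - risk (P t (past h t)) f)| ≤ m := by
  refine (Finset.abs_sum_le_sum_abs _ _).trans ?_
  refine (Finset.sum_le_sum (g := fun _ => (1 : ℝ)) fun t _ => ?_).trans (by simp)
  have := hP t
  rw [abs_le]
  constructor <;> linarith [loss_nonneg (h t) f, loss_le_one (h t) f,
    risk_nonneg (P t (past h t)) f, risk_le_one (P t (past h t)) f]

theorem funBdd_preqPot [Nonempty X] (A : Rules F) {G : Set (X → Bool)} (hG : G.Nonempty)
    {P : CondLaws X} (hP : ∀ t, IsMarkovKernel (P t)) (n m : ℕ) : FunBdd (preqPot A G P n m) := by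
  have : Nonempty G := hG.to_subtype
  refine FunBdd.add ⟨2 * m, fun h => ?_⟩ ((unifBdd_pot abs_gain_le unifBdd_supT _).funBdd
    ⟨m, fun h f => abs_sum_loss_sub_risk_le hP h f.1⟩)
  refine (Finset.abs_sum_le_sum_abs _ _).trans ?_
  refine (Finset.sum_le_sum (g := fun _ => (2 : ℝ)) fun t _ => ?_).trans (by simp [mul_comm])
  have := hP t
  refine (abs_sub _ _).trans ?_
  linarith [abs_randRisk_le (P t (past h t)) (A t (past h t)),
    abs_randLoss_le (h t) (A t (past h t))]

/-- The potential need not be measurable in the new observation, so the upper expectation is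
replaced by a mean that attains it and extends the integral. By linearity the rule's term, risk
minus loss, averages to at most zero, and symmetrization absorbs the centred losses of the class
into one round. The constants `a` and `b` allow for normalization. -/
theorem upperExp_preqPot_le [Nonempty X] (hmeas : ∀ f ∈ F, Measurable f) {A : Rules F}
    (hA : ∀ t h, FiniteLaw (A t h)) {G : Set (X → Bool)} (hGF : G ⊆ F) (hG : G.Nonempty)
    {P : CondLaws X} (hP : ∀ t, IsMarkovKernel (P t)) {n m : ℕ} (hm : m < n) (a b : ℝ)
    (ha : 0 ≤ a) (h : Fin m → X × Bool) :
    upperExp (P m h) (fun z => b + a * preqPot A G P n (m + 1) (Fin.snoc h z)) ≤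
      b + a * preqPot A G P n m h := by
  have : Nonempty G := hG.to_subtype
  have := hP m
  obtain ⟨C, hC⟩ := funBdd_preqPot A hG hP n (m + 1)
  have hpb : FunBdd fun z => preqPot A G P n (m + 1) (Fin.snoc h z) := ⟨C, fun z => hC _⟩
  obtain ⟨μ, hμ, hμ₀, hμi⟩ := exists_isMean_upperExp (μ := P m h)
    ((FunBdd.const b).add (hpb.smul a))
  change upperExp (P m h) ((fun _ => b) + a • fun z => preqPot A G P n (m + 1) (Fin.snoc h z)) ≤ _
  rw [← hμ₀, hμ.add _ _ (FunBdd.const b) (hpb.smul a), hμ.const, hμ.smul _ _ hpb]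
  refine add_le_add le_rfl (mul_le_mul_of_nonneg_left ?_ ha)
  set S : G → ℝ := fun f => ∑ t : Fin m, (loss (h t) f.1 - risk (P t (past h t)) f.1) with hS
  have hSb : FunBdd S := ⟨m, fun f => abs_sum_loss_sub_risk_le hP h f.1⟩
  have hlb : FunBdd fun z => randLoss z (A m h) := ⟨1, fun z => abs_randLoss_le z _⟩
  have hrisk : ∀ f : G, risk (P m h) f.1 = μ fun z => loss z f.1 := fun f =>
    (hμi _ ⟨1, fun z => abs_loss_le z f.1⟩ (measurable_loss (hmeas _ (hGF f.2)))).symm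
  have hrand : randRisk (P m h) (A m h) ≤ μ fun z => randLoss z (A m h) := by
    have hmz := (hA m h).measurable_randLoss hmeas
    rw [hμi _ hlb hmz]
    exact upperExp_le_integral hlb hmz (Integrable.of_bound hmz.aestronglyMeasurable 1
      (Eventually.of_forall fun z => abs_randLoss_le z _)) fun _ => le_rfl
  -- Flipping the label makes the gain `2 * loss - 1`, so that half the centred gain is exactly loss
  -- minus risk.
  let ζ : X × Bool → X × Bool := fun z => (z.1, !z.2)
  have hζ : ∀ z (f : G), gain (fun f : G => f.1) (ζ z) f = 2 * loss z f.1 - 1 := fun z f => by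
    rw [loss_eq]
    simp only [gain, ζ]
    cases z.2 <;> cases f.1 z.1 <;> norm_num [sgn]
  have hsym := pot_symmetrization (g := gain fun f : G => f.1) abs_gain_le unifBdd_supT hμ
    (jensen_supT hμ) (jensen_supT isMean_boolMean) (n - m - 1) ζ hSb
  have hcentre : ∀ z, (fun f : G => S f + (loss z f.1 - risk (P m h) f.1)) = fun f : G => S f +
      (gain (fun f : G => f.1) (ζ z) f - μ fun w => gain (fun f : G => f.1) (ζ w) f) / 2 := by
    intro z
    ext f
    have hb : FunBdd fun w => loss w f.1 := ⟨1, fun z => abs_loss_le z f.1⟩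
    have h1 : (μ fun w => gain (fun f : G => f.1) (ζ w) f) =
        -1 + 2 * risk (P m h) f.1 := by
      rw [hrisk, ← hμ.smul _ _ hb, ← hμ.const_add _ (hb.smul _)]
      congr 1
      ext w
      rw [hζ, Pi.smul_apply, smul_eq_mul]
      ring
    rw [h1, hζ]
    ring
  rw [show n - m - 1 + 1 = n - m by omega] at hsym
  set c := ∑ t : Fin m,
    (randRisk (P t (past h t)) (A t (past h t)) - randLoss (h t) (A t (past h t))) with hc
  have hdecomp : (fun z => preqPot A G P n (m + 1) (Fin.snoc h z)) =
      ((fun _ => c + randRisk (P m h) (A m h)) + (-1 : ℝ) • fun z => randLoss z (A m h)) +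
      fun z => pot (gain fun f : G => f.1) supT (n - m - 1) fun f : G => S f +
        (gain (fun f : G => f.1) (ζ z) f - μ fun w => gain (fun f : G => f.1) (ζ w) f) / 2 := by
    ext z
    rw [preqPot_snoc, hcentre]
    simp only [Pi.add_apply, Pi.smul_apply, smul_eq_mul]
    ring
  have hfirst : FunBdd ((fun _ : X × Bool => c + randRisk (P m h) (A m h)) +
      (-1 : ℝ) • fun z => randLoss z (A m h)) := (FunBdd.const _).add (hlb.smul _)
  have hsecond : FunBdd fun z => pot (gain fun f : G => f.1) supT (n - m - 1) fun f : G => S f +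
      (gain (fun f : G => f.1) (ζ z) f - μ fun w => gain (fun f : G => f.1) (ζ w) f) / 2 := by
    have := hpb.sub hfirst
    rwa [hdecomp, add_sub_cancel_left] at this
  rw [hdecomp, hμ.add _ _ hfirst hsecond, hμ.add _ _ (FunBdd.const _) (hlb.smul _), hμ.const,
    hμ.smul _ _ hlb, preqPot]
  linarith

/-- The regret in risks splits into risk minus loss of the rule, the online regret on the realized
path, and loss minus risk of the comparator. The hypothesis bounds the middle term; the other two
form the terminal potential. -/
theorem preqRegret_le_preqPot {A : Rules F} {G : Set (X → Bool)} (hGF : G ⊆ F) (hG : G.Nonempty)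
    {P : CondLaws X} (hP : ∀ t, IsMarkovKernel (P t)) {n : ℕ} {B : ℝ}
    (hA : ∀ z : Fin n → X × Bool, ∑ t, randLoss (z t) (A t (past z t)) ≤
      (⨅ f : F, ∑ t, loss (z t) f.1) + B) (z : Fin n → X × Bool) :
    preqRegret A G P z ≤ 1 / (n : ℝ) * B + 1 / (n : ℝ) * preqPot A G P n n z := by
  have : Nonempty G := hG.to_subtype
  have hn : (0 : ℝ) ≤ 1 / n := by positivity
  rw [preqRegret, sub_le_iff_le_add, ← sub_le_iff_le_add', ← Real.mul_iInf_of_nonneg hn,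
    ← mul_add, ← mul_sub]
  refine mul_le_mul_of_nonneg_left (le_ciInf fun f => ?_) hn
  have h1 := hA z
  have h2 : ⨅ f : F, ∑ t, loss (z t) f.1 ≤ ∑ t, loss (z t) f.1 :=
    ciInf_le ⟨0, by rintro _ ⟨f, rfl⟩; exact Finset.sum_nonneg fun t _ => loss_nonneg _ _⟩
      (⟨f.1, hGF f.2⟩ : F)
  have h3 : ∑ t, (loss (z t) f.1 - risk (P t (past z t)) f.1) ≤
      supT fun f : G => ∑ t, (loss (z t) f.1 - risk (P t (past z t)) f.1) := by
    have hb : FunBdd fun f : G => ∑ t, (loss (z t) f.1 - risk (P t (past z t)) f.1) :=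
      ⟨n, fun f => abs_sum_loss_sub_risk_le hP z f.1⟩
    exact le_ciSup hb.bddAbove f
  rw [Finset.sum_sub_distrib] at h3
  rw [preqPot, Nat.sub_self, Finset.sum_sub_distrib]
  simp only [pot]
  linarith

theorem prequentiallyLearnable_of_ldim (hF : F.Nonempty) (hmeas : ∀ f ∈ F, Measurable f)
    (h : ldim F < ⊤) : PrequentiallyLearnable F := by
  have : Nonempty F := hF.to_subtype
  have : Nonempty (Rules F) := nonempty_rules hF
  obtain ⟨D, hD⟩ := exists_not_hasTree h
  refine limsup_eq_zero_of_eventually ?_ fun ε hε => ?_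
  · filter_upwards [eventually_ge_atTop 1] with n hn
    exact le_ciInf fun A => preqWorst_nonneg hF hmeas A hn
  -- The thirds pay for the game over `F`, the slack in the online rules, and the game over the
  -- countable class `G`.
  · have hε3 : 0 < ε / 3 := by positivity
    filter_upwards [eventually_potBound_le D hε3, eventually_ge_atTop 1] with n hn hn1
    have hbelow : BddBelow (Set.range fun A : Rules F => preqWorst A n) :=
      ⟨0, by rintro _ ⟨A, rfl⟩; exact preqWorst_nonneg hF hmeas A hn1⟩
    have hn0 : (0 : ℝ) < n := by exact_mod_cast hn1
    rcases isEmpty_or_nonempty X with hX | hX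
    · refine (ciInf_le hbelow (Classical.arbitrary _)).trans (Real.sSup_le ?_ hε.le)
      rintro _ ⟨P, G, hP, -⟩
      have := hP 0
      have h := (inferInstance : IsProbabilityMeasure (P 0 Fin.elim0)).measure_univ
      rw [Set.univ_eq_empty_iff.2 inferInstance, measure_empty] at h
      exact absurd h zero_ne_one
    · obtain ⟨A, hAfin, hA⟩ := exists_rules (F := F) n hε3
      refine (ciInf_le hbelow A).trans (Real.sSup_le ?_ hε.le)
      rintro _ ⟨P, G, hP, hGF, -, hG, rfl⟩
      have : Nonempty G := hG.to_subtype
      set B := pot (gain fun f : F => f.1) supT n 0 + n * (ε / 3) with hB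
      set Φ : (m : ℕ) → (Fin m → X × Bool) → ℝ := fun m h =>
        1 / (n : ℝ) * B + 1 / (n : ℝ) * preqPot A G P n m h with hΦ
      have hΦb : ∀ m, FunBdd (Φ m) := fun m =>
        (FunBdd.const _).add ((funBdd_preqPot A hG hP n m).smul _)
      have h1 := processExp_mono hP (φ := fun z => preqRegret A G P z) (ψ := Φ n)
        ⟨1, abs_preqRegret_le A hG hP⟩ (hΦb n)
        (preqRegret_le_preqPot hGF hG hP fun z => by rw [← add_assoc]; exact hA z)
      have h2 := processExp_le_of_supermartingale hP Φ hΦb n fun m hm h =>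
        upperExp_preqPot_le hmeas hAfin hGF hG hP hm _ _ (by positivity) h
      have h3 : Φ 0 Fin.elim0 = 1 / (n : ℝ) * B +
          1 / (n : ℝ) * pot (gain fun f : G => f.1) supT n 0 := by
        simp only [hΦ, preqPot, Finset.univ_eq_empty, Finset.sum_empty, zero_add, Nat.sub_zero]
        rfl
      have h4 := pot_supT_le (hD (fun f : F => f.1) fun f => f.2) hε3 n
      have h5 := pot_supT_le (hD (fun f : G => f.1) fun f => hGF f.2) hε3 n
      refine (h1.trans h2).trans ?_
      rw [h3, ← mul_add, one_div_mul_eq_div, div_le_iff₀ hn0]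
      linarith

end Risk


/-! ### The uniform martingale law of large numbers: upper bound -/

section MartingaleUpper

/-- The potential is 1-Lipschitz in the supremum norm. Continuity supplies the measurability that a
supremum over uncountably many points would not give directly. -/
theorem continuous_pot_absT {Z I : Type*} [Nonempty Z] [Nonempty I] [Finite I] {g : Z → I → ℝ}
    (hg : ∀ z i, |g z i| ≤ 1) (k : ℕ) : Continuous (pot g absT k) := by
  have := Fintype.ofFinite I
  have hlip : ∀ S S' : I → ℝ, pot g absT k S ≤ pot g absT k S' + dist S S' := fun S S' =>
    pot_lipschitz hg unifBdd_absT (fun _ _ _ _ hS' h => absT_le_add hS' h) k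
      (FunBdd.of_finite S) (FunBdd.of_finite S') fun i => dist_le_pi_dist S S' i
  exact (LipschitzWith.of_le_add hlip).continuous

variable {X I : Type*} {e : I → X → Bool} {Ω : Type*} {m₀ : MeasurableSpace Ω} {μ : Measure Ω}

theorem measurable_of_apply {Ω J β : Type*} {m : MeasurableSpace Ω} [MeasurableSpace β]
    {u : Ω → J → β} (h : ∀ j, Measurable fun ω => u ω j) : Measurable u :=
  measurable_pi_lambda u h

theorem measurable_sgn : Measurable sgn := measurable_of_finite _

theorem abs_condExp_sgn_le {m : MeasurableSpace Ω} (f : Ω → Bool) :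
    ∀ᵐ ω ∂μ, |(μ[fun ω => sgn (f ω) | m]) ω| ≤ 1 :=
  ae_bdd_abs_condExp_of_ae_bdd_abs (Eventually.of_forall fun _ => (abs_sgn _).le)

/-- The centred value of the `i`-th function at time `t`. -/
def centred (e : I → X → Bool) (μ : Measure Ω) (𝒜 : Filtration ℕ m₀) (ξ : ℕ → Ω → X) (t : ℕ)
    (ω : Ω) (i : I) : ℝ :=
  sgn (e i (ξ t ω)) - (μ[fun ω' => sgn (e i (ξ t ω')) | 𝒜 t]) ω

theorem abs_centred_le (𝒜 : Filtration ℕ m₀) (ξ : ℕ → Ω → X) (t : ℕ) (i : I) :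
    ∀ᵐ ω ∂μ, |centred e μ 𝒜 ξ t ω i| ≤ 2 := by
  filter_upwards [abs_condExp_sgn_le (μ := μ) (m := 𝒜 t) fun ω => e i (ξ t ω)] with ω h
  refine (abs_sub _ _).trans ?_
  rw [abs_sgn]
  linarith

variable [MeasurableSpace X]

theorem measurable_centred (he : ∀ i, Measurable (e i)) {𝒜 : Filtration ℕ m₀} {ξ : ℕ → Ω → X}
    (hξ : ∀ t, Measurable[𝒜 (t + 1)] (ξ t)) (t : ℕ) (i : I) :
    Measurable[𝒜 (t + 1)] fun ω => centred e μ 𝒜 ξ t ω i :=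
  (measurable_sgn.comp ((he i).comp (hξ t))).sub
    (stronglyMeasurable_condExp.measurable.mono (𝒜.mono (Nat.le_succ t)) le_rfl)

variable [Nonempty X] [Nonempty I] [Fintype I] [IsProbabilityMeasure μ]

/-- For a finite family, the new point matters only through its pattern of labels, which takes
finitely many values. Conditional probabilities of patterns are almost surely a probability vector,
so symmetrization applies pointwise in `ω` and no regular conditional law is needed. -/
theorem integral_pot_step_le (he : ∀ i, Measurable (e i)) {m : MeasurableSpace Ω} (hm : m ≤ m₀)
    {η : Ω → X} (hη : Measurable[m₀] η) {S : Ω → I → ℝ} (hS : ∀ i, Measurable[m] fun ω => S ω i)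
    {C : ℝ} (hC : ∀ᵐ ω ∂μ, ∀ i, |S ω i| ≤ C) (k : ℕ) :
    ∫ ω, pot (gain e) absT k
        (fun i => S ω i + (sgn (e i (η ω)) - (μ[fun ω => sgn (e i (η ω)) | m]) ω) / 2) ∂μ ≤
      ∫ ω, pot (gain e) absT (k + 1) (S ω) ∂μ := by
  classical
  let W := Set.range fun (x : X) (i : I) => e i x
  have : Fintype W := Fintype.ofFinite W
  let pat : Ω → W := fun ω => ⟨fun i => e i (η ω), η ω, rfl⟩
  have hpat : Measurable[m₀] pat :=
    Measurable.subtype_mk (measurable_of_apply fun i => (he i).comp hη)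
  let c : I → Ω → ℝ := fun i => μ[fun ω => sgn (e i (η ω)) | m]
  have hc1 : ∀ᵐ ω ∂μ, ∀ i, |c i ω| ≤ 1 := ae_all_iff.2 fun i => abs_condExp_sgn_le _
  let ι : W → Ω → ℝ := fun w ω => if pat ω = w then 1 else 0
  have hιm : ∀ w, Measurable[m₀] (ι w) := fun w =>
    (measurable_of_finite fun w' : W => if w' = w then (1 : ℝ) else 0).comp hpat
  have hιb : ∀ w ω, |ι w ω| ≤ 1 := fun w ω => by
    simp only [ι]
    split_ifs <;> simp
  have hιi : ∀ w, Integrable (ι w) μ := fun w =>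
    Integrable.of_bound (hιm w).aestronglyMeasurable 1 (Eventually.of_forall (hιb w))
  have hselect : ∀ (u : W → ℝ) ω, ∑ w, u w * ι w ω = u (pat ω) := fun u ω => by
    simp [ι]
  let p : W → Ω → ℝ := fun w => μ[ι w | m]
  have hp0 : ∀ᵐ ω ∂μ, ∀ w, 0 ≤ p w ω := ae_all_iff.2 fun w =>
    condExp_nonneg (Eventually.of_forall fun ω => by
      simp only [ι, Pi.zero_apply]
      split_ifs <;> norm_num)
  have hlin : ∀ u : W → ℝ, (μ[fun ω => u (pat ω) | m]) =ᵐ[μ] fun ω => ∑ w, p w ω * u w := by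
    intro u
    have h1 : (fun ω => u (pat ω)) = ∑ w, u w • ι w := by
      ext ω
      simp only [Finset.sum_apply, Pi.smul_apply, smul_eq_mul, hselect]
    rw [h1]
    have h2 := condExp_finsetSum (μ := μ) (s := Finset.univ) (f := fun w => u w • ι w)
      (fun w _ => (hιi w).smul _) m
    have h3 : ∀ᵐ ω ∂μ, ∀ w, (μ[u w • ι w | m]) ω = u w * p w ω := ae_all_iff.2 fun w =>
      condExp_smul (u w) (ι w) m
    filter_upwards [h2, h3] with ω h2 h3
    rw [h2, Finset.sum_apply]
    exact Finset.sum_congr rfl fun w _ => by rw [h3, mul_comm]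
  have hp1 : ∀ᵐ ω ∂μ, ∑ w, p w ω = 1 := by
    have h1 := hlin fun _ => 1
    rw [condExp_const hm] at h1
    filter_upwards [h1] with ω h1
    simpa using h1.symm
  have hpc : ∀ᵐ ω ∂μ, ∀ i, c i ω = ∑ w, p w ω * sgn (w.1 i) :=
    ae_all_iff.2 fun i => hlin fun w => sgn (w.1 i)
  let H : W → Ω → ℝ := fun w ω =>
    pot (gain e) absT k fun i => S ω i + (sgn (w.1 i) - c i ω) / 2
  have hcont := continuous_pot_absT (g := gain e) abs_gain_le
  have hHm : ∀ w, StronglyMeasurable[m] (H w) := fun w =>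
    Measurable.stronglyMeasurable ((hcont k).measurable.comp (measurable_of_apply fun i =>
      (hS i).add (((measurable_const).sub
        (stronglyMeasurable_condExp.measurable)).div_const 2)))
  obtain ⟨M, hM⟩ := unifBdd_pot (g := gain e) abs_gain_le unifBdd_absT k (C + 1)
  have hHb : ∀ w, ∀ᵐ ω ∂μ, |H w ω| ≤ M := fun w => by
    filter_upwards [hC, hc1] with ω h1 h2
    refine hM _ fun i => (abs_add_le _ _).trans (add_le_add (h1 i) ?_)
    have h3 := abs_le.1 (h2 i)
    have h4 := abs_le.1 (abs_sgn (w.1 i)).le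
    rw [abs_le]
    constructor <;> linarith [h3.1, h3.2, h4.1, h4.2]
  have hHi : ∀ w, Integrable (H w) μ := fun w =>
    Integrable.of_bound ((hHm w).mono hm).aestronglyMeasurable M (hHb w)
  have hHιi : ∀ w, Integrable (H w * ι w) μ := fun w =>
    (hHi w).mul_bdd (c := 1) (hιm w).aestronglyMeasurable (Eventually.of_forall (hιb w))
  -- With the pattern frozen at `w`, the potential is known at the earlier time and comes out of the
  -- conditional expectation.
  have hpull : ∀ w, μ[H w * ι w | m] =ᵐ[μ] H w * p w := fun w =>
    condExp_mul_of_stronglyMeasurable_left (hHm w) (hHιi w) (hιi w)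
  have hHpi : ∀ w, Integrable (H w * p w) μ := fun w => integrable_condExp.congr (hpull w)
  have hSi : Integrable (fun ω => pot (gain e) absT (k + 1) (S ω)) μ := by
    obtain ⟨M', hM'⟩ := unifBdd_pot (g := gain e) abs_gain_le unifBdd_absT (k + 1) C
    refine Integrable.of_bound ((hcont (k + 1)).measurable.comp (measurable_of_apply fun i =>
      (hS i).mono hm le_rfl)).aestronglyMeasurable M' ?_
    filter_upwards [hC] with ω h using hM' _ h
  calc ∫ ω, pot (gain e) absT k (fun i => S ω i + (sgn (e i (η ω)) - c i ω) / 2) ∂μ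
      = ∫ ω, ∑ w, (H w * ι w) ω ∂μ := by
        congr 1
        ext ω
        simp only [Pi.mul_apply]
        rw [hselect (fun w => H w ω) ω]
    _ = ∑ w, ∫ ω, (H w * ι w) ω ∂μ := integral_finsetSum _ fun w _ => hHιi w
    _ = ∑ w, ∫ ω, (H w * p w) ω ∂μ := Finset.sum_congr rfl fun w _ => by
        rw [← integral_condExp hm (f := H w * ι w)]
        exact integral_congr_ae (hpull w)
    _ = ∫ ω, ∑ w, (H w * p w) ω ∂μ := (integral_finsetSum _ fun w _ => hHpi w).symm
    _ ≤ ∫ ω, pot (gain e) absT (k + 1) (S ω) ∂μ := by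
        refine integral_mono_ae (integrable_finsetSum _ fun w _ => hHpi w) hSi ?_
        filter_upwards [hp0, hp1, hpc] with ω h0 h1 h2
        have hmean := isMean_weights h0 h1
        -- Patterns in `W` are realized by actual points, hence are legal moves of the adversary;
        -- label `true` makes the gain the bare sign.
        have hx : ∀ w : W, ∃ x, (fun i => e i x) = w.1 := fun w => w.2
        choose x hx using hx
        have hsym := pot_symmetrization (g := gain e) abs_gain_le unifBdd_absT hmean
          (jensen_absT hmean) (jensen_absT isMean_boolMean) k (fun w => (x w, true))
          (FunBdd.of_finite (S ω))
        have hgain : ∀ (w : W) i, gain e (x w, true) i = sgn (w.1 i) := fun w i => by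
          rw [← hx w]
          simp [gain, sgn]
        simp only [hgain, ← h2] at hsym
        refine le_trans (le_of_eq ?_) hsym
        exact Finset.sum_congr rfl fun w _ => mul_comm _ _

/-- Trading one martingale step for one round of the game, `n` times, interpolates between the two
sides. The increments are halved because symmetrization halves them. -/
theorem integral_absT_centred_le (he : ∀ i, Measurable (e i)) {𝒜 : Filtration ℕ m₀}
    {ξ : ℕ → Ω → X} (hξ : ∀ t, Measurable[𝒜 (t + 1)] (ξ t)) (n : ℕ) :
    ∫ ω, absT (fun i => ∑ t ∈ Finset.range n, centred e μ 𝒜 ξ t ω i / 2) ∂μ ≤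
      pot (gain e) absT n 0 := by
  have key : ∀ m ≤ n, ∫ ω, pot (gain e) absT (n - m)
      (fun i => ∑ t ∈ Finset.range m, centred e μ 𝒜 ξ t ω i / 2) ∂μ ≤
      pot (gain e) absT n 0 := by
    intro m
    induction m with
    | zero =>
      intro _
      simp only [Finset.range_zero, Finset.sum_empty, Nat.sub_zero, integral_const,
        probReal_univ, one_smul]
      exact le_rfl
    | succ m ih =>
      intro hm
      refine le_trans ?_ (ih (by omega))
      have hS : ∀ i, Measurable[𝒜 m]
          fun ω => ∑ t ∈ Finset.range m, centred e μ 𝒜 ξ t ω i / 2 := fun i =>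
        Finset.measurable_sum _ fun t ht => ((measurable_centred he hξ t i).mono
          (𝒜.mono (Finset.mem_range.1 ht)) le_rfl).div_const 2
      have hC : ∀ᵐ ω ∂μ, ∀ i, |∑ t ∈ Finset.range m, centred e μ 𝒜 ξ t ω i / 2| ≤ m := by
        have h : ∀ᵐ ω ∂μ, ∀ i t, |centred e μ 𝒜 ξ t ω i| ≤ 2 :=
          ae_all_iff.2 fun i => ae_all_iff.2 fun t => abs_centred_le 𝒜 ξ t i
        filter_upwards [h] with ω h i
        refine (Finset.abs_sum_le_sum_abs _ _).trans ?_
        refine (Finset.sum_le_sum (g := fun _ => (1 : ℝ)) fun t _ => ?_).trans (by simp)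
        rw [abs_div, abs_two]
        linarith [h i t]
      have h := integral_pot_step_le he (𝒜.le m) ((hξ m).mono (𝒜.le (m + 1)) le_rfl) hS hC
        (n - (m + 1))
      rw [show n - (m + 1) + 1 = n - m by omega] at h
      refine le_trans (le_of_eq ?_) h
      simp only [Finset.sum_range_succ]
      rfl
  have h := key n le_rfl
  rwa [Nat.sub_self] at h

end MartingaleUpper


/-! ### From finite families to countable classes -/

section MartingaleValue

universe u

variable {X : Type u} {Ω : Type u} {mΩ : MeasurableSpace Ω} {μ : Measure Ω}
  {𝒜 : Filtration ℕ mΩ} {ξ : ℕ → Ω → X}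

theorem martingaleDeviation_nonneg (G : Set (X → Bool)) (n : ℕ) :
    0 ≤ martingaleDeviation G n μ 𝒜 ξ :=
  integral_nonneg fun _ => Real.iSup_nonneg fun _ => abs_nonneg _

theorem ae_abs_average_le_two {G : Set (X → Bool)} (hG : G.Countable) (n : ℕ) :
    ∀ᵐ ω ∂μ, ∀ f : G, |(1 / (n : ℝ)) * ∑ t ∈ Finset.range n,
      (sgn (f.1 (ξ t ω)) - (μ[fun ω' => sgn (f.1 (ξ t ω')) | 𝒜 t]) ω)| ≤ 2 := by
  have := hG.to_subtype
  have h : ∀ᵐ ω ∂μ, ∀ (f : G) t, |centred (fun f : G => f.1) μ 𝒜 ξ t ω f| ≤ 2 :=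
    ae_all_iff.2 fun f => ae_all_iff.2 fun t => abs_centred_le 𝒜 ξ t f
  filter_upwards [h] with ω h f
  rw [abs_mul, abs_of_nonneg (show (0 : ℝ) ≤ 1 / n by positivity), one_div_mul_eq_div]
  refine div_le_of_le_mul₀ (by positivity) (by positivity) ?_
  refine (Finset.abs_sum_le_sum_abs _ _).trans ?_
  exact (Finset.sum_le_sum fun t _ => h f t).trans (by simp [mul_comm])

variable [IsProbabilityMeasure μ]

theorem martingaleDeviation_le_two {G : Set (X → Bool)} (hG : G.Countable) (n : ℕ) :
    martingaleDeviation G n μ 𝒜 ξ ≤ 2 := by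
  have h := integral_mono_of_nonneg (μ := μ) (f := fun ω => ⨆ f : G, |(1 / (n : ℝ)) *
    ∑ t ∈ Finset.range n, (sgn (f.1 (ξ t ω)) - (μ[fun ω' => sgn (f.1 (ξ t ω')) | 𝒜 t]) ω)|)
    (g := fun _ => 2) (Eventually.of_forall fun ω => Real.iSup_nonneg fun _ => abs_nonneg _)
    (integrable_const _) (by
      filter_upwards [ae_abs_average_le_two hG n] with ω h using Real.iSup_le h zero_le_two)
  simpa [martingaleDeviation] using h

/-- Finite initial segments exhaust the countable class, and dominated convergence with the constant
2 passes to the limit. The factor `2 / n` undoes the halving and normalizes. -/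
theorem martingaleDeviation_le [MeasurableSpace X] {G : Set (X → Bool)}
    (hmeas : ∀ f ∈ G, Measurable f) (hG : G.Countable) (hne : G.Nonempty)
    (hξ : ∀ t, Measurable[𝒜 (t + 1)] (ξ t)) {n : ℕ} {B : ℝ}
    (hB : ∀ (j : ℕ) (e : Fin (j + 1) → X → Bool), (∀ i, e i ∈ G) →
      pot (gain e) absT n 0 ≤ B) :
    martingaleDeviation G n μ 𝒜 ξ ≤ 2 / n * B := by
  obtain ⟨ω₀⟩ := nonempty_of_isProbabilityMeasure μ
  have : Nonempty X := ⟨ξ 0 ω₀⟩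
  obtain ⟨e, rfl⟩ := hG.exists_eq_range hne
  have he : ∀ i, Measurable (e i) := fun i => hmeas _ ⟨i, rfl⟩
  let D : (X → Bool) → Ω → ℝ := fun f ω => |(1 / (n : ℝ)) * ∑ t ∈ Finset.range n,
      (sgn (f (ξ t ω)) - (μ[fun ω' => sgn (f (ξ t ω')) | 𝒜 t]) ω)|
  let S : (j : ℕ) → Ω → Fin (j + 1) → ℝ := fun j ω i => ∑ t ∈ Finset.range n,
    centred (fun i : Fin (j + 1) => e i) μ 𝒜 ξ t ω i / 2
  have hSD : ∀ j ω i, 2 / n * |S j ω i| = D (e i) ω := fun j ω i => by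
    have h : S j ω i = (∑ t ∈ Finset.range n, (sgn (e i (ξ t ω)) -
        (μ[fun ω' => sgn (e i (ξ t ω')) | 𝒜 t]) ω)) / 2 := (Finset.sum_div _ _ _).symm
    rw [h]
    simp only [D]
    rw [abs_div, abs_two, abs_mul, abs_of_nonneg (show (0 : ℝ) ≤ 1 / n by positivity)]
    ring
  have hDm : ∀ f, Measurable f → Measurable (D f) := fun f hf => by
    refine Measurable.abs (Measurable.const_mul (Finset.measurable_sum _ fun t _ => ?_) _)
    exact (measurable_sgn.comp (hf.comp ((hξ t).mono (𝒜.le _) le_rfl))).sub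
      (stronglyMeasurable_condExp.measurable.mono (𝒜.le t) le_rfl)
  let u : ℕ → Ω → ℝ := fun j ω => ⨆ i : Fin (j + 1), D (e i) ω
  have hbound : ∀ j, ∫ ω, u j ω ∂μ ≤ 2 / n * B := fun j => by
    have h1 : u j = fun ω => 2 / n * absT (S j ω) := by
      ext ω
      simp only [u, absT]
      rw [Real.mul_iSup_of_nonneg (by positivity)]
      simp only [hSD]
    rw [h1, integral_const_mul]
    refine mul_le_mul_of_nonneg_left ?_ (by positivity)
    exact (integral_absT_centred_le (e := fun i : Fin (j + 1) => e i)
      (fun i => he i) hξ n).trans (hB j _ fun i => ⟨i, rfl⟩)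
  have hae := ae_abs_average_le_two (μ := μ) (𝒜 := 𝒜) (ξ := ξ) hG n
  have htend : Tendsto (fun j => ∫ ω, u j ω ∂μ) atTop
      (nhds (∫ ω, ⨆ f : Set.range e, D f.1 ω ∂μ)) := by
    refine tendsto_integral_of_dominated_convergence (fun _ => 2) (fun j => ?_)
      (integrable_const _) (fun j => ?_) ?_
    · exact (Measurable.iSup fun i => hDm _ (he _)).aestronglyMeasurable
    · filter_upwards [hae] with ω h
      rw [Real.norm_of_nonneg (Real.iSup_nonneg fun _ => abs_nonneg _)]
      exact ciSup_le fun i => h ⟨e i, i, rfl⟩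
    · filter_upwards [hae] with ω h
      have hfin : ∀ j, BddAbove (Set.range fun i : Fin (j + 1) => D (e i) ω) := fun j =>
        (Set.finite_range _).bddAbove
      have hbdd : BddAbove (Set.range fun f : Set.range e => D f.1 ω) :=
        ⟨2, by rintro _ ⟨f, rfl⟩; exact h f⟩
      refine tendsto_atTop_isLUB (fun j k hjk => ?_) ⟨?_, ?_⟩
      · exact ciSup_le fun i => le_ciSup (hfin k) (Fin.castLE (by omega) i)
      · rintro _ ⟨j, rfl⟩
        exact ciSup_le fun i => le_ciSup hbdd ⟨e i, i, rfl⟩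
      · intro b hb
        have : Nonempty (Set.range e) := hne.to_subtype
        refine ciSup_le ?_
        rintro ⟨_, i, rfl⟩
        exact (le_ciSup (hfin i) (Fin.last i)).trans (hb ⟨i, rfl⟩)
  exact le_of_tendsto' htend hbound

end MartingaleValue

section UMLLN

universe u

variable {X : Type u} [MeasurableSpace X] {F : Set (X → Bool)}

theorem martingaleValue_nonneg (n : ℕ) : 0 ≤ martingaleValue F n := by
  refine Real.sSup_nonneg ?_
  rintro _ ⟨Ω, mΩ, μ, 𝒜, ξ, G, hμ, hξ, hGF, hG, hne, rfl⟩
  exact martingaleDeviation_nonneg G n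

theorem umlln_of_ldim (hmeas : ∀ f ∈ F, Measurable f) (h : ldim F < ⊤) : UMLLN F := by
  obtain ⟨D, hD⟩ := exists_not_hasTree h
  refine limsup_eq_zero_of_eventually (Eventually.of_forall martingaleValue_nonneg)
    fun ε hε => ?_
  filter_upwards [eventually_potBound_le D (half_pos hε), eventually_ge_atTop 1] with n hn hn1
  have hn0 : (0 : ℝ) < n := by exact_mod_cast hn1
  refine Real.sSup_le ?_ hε.le
  rintro _ ⟨Ω, mΩ, μ, 𝒜, ξ, G, hμ, hξ, hGF, hG, hne, rfl⟩
  obtain ⟨ω₀⟩ := nonempty_of_isProbabilityMeasure μ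
  have : Nonempty X := ⟨ξ 0 ω₀⟩
  refine (martingaleDeviation_le (fun f hf => hmeas f (hGF hf)) hG hne hξ (B := ε / 2 * n)
    fun j e he => ?_).trans (le_of_eq (by field_simp))
  exact (pot_absT_le (hD e fun i => hGF (he i)) (half_pos hε) n).trans hn

end UMLLN


/-! ### The uniform martingale law of large numbers: lower bound -/

section SignSpace

universe u

/-- The sign sequences of length `n`, in an arbitrary universe. -/
abbrev SignSpace (n : ℕ) : Type u := ULift.{u} (Fin n → Bool)

variable {n : ℕ}

/-- The uniform distribution on sign sequences. -/
def uniformSigns (n : ℕ) : @Measure (SignSpace.{u} n) ⊤ :=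
  @PMF.toMeasure (SignSpace.{u} n) ⊤ (PMF.uniformOfFintype (SignSpace.{u} n))

/-- A sign sequence with the entries from time `t` on erased. -/
def truncate (t : ℕ) (ω : SignSpace.{u} n) : Fin n → Bool :=
  fun i => if i.1 < t then ω.down i else false

/-- The filtration generated by the signs. -/
def signFiltration (n : ℕ) : @Filtration (SignSpace.{u} n) ℕ _ ⊤ :=
  @Filtration.mk (SignSpace.{u} n) ℕ _ ⊤ (fun t => MeasurableSpace.comap (truncate t) ⊤)
    (fun s t hst => by
      have h : truncate s = (fun (η : Fin n → Bool) (i : Fin n) =>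
          if i.1 < s then η i else false) ∘ (truncate t : SignSpace.{u} n → Fin n → Bool) := by
        ext ω i
        simp only [truncate, Function.comp_apply]
        split_ifs with h1 h2
        · rfl
        · omega
        · rfl
      change MeasurableSpace.comap (truncate s) ⊤ ≤ MeasurableSpace.comap (truncate t) ⊤
      rw [h, ← MeasurableSpace.comap_comp]
      exact MeasurableSpace.comap_mono le_top)
    (fun t => le_top)

/-- The change of the sign at time `t`. -/
def flipSign (t : Fin n) : Equiv.Perm (SignSpace.{u} n) :=
  Function.Involutive.toPerm (fun ω => ⟨Function.update ω.down t (!ω.down t)⟩) fun ω => by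
    apply ULift.ext
    simp

theorem flipSign_apply_self (t : Fin n) (ω : SignSpace.{u} n) :
    (flipSign t ω).down t = !ω.down t := by
  change Function.update ω.down t (!ω.down t) t = _
  simp

theorem flipSign_apply_of_ne {s t : Fin n} (h : s ≠ t) (ω : SignSpace.{u} n) :
    (flipSign t ω).down s = ω.down s := by
  change Function.update ω.down t (!ω.down t) s = _
  simp [h]

theorem truncate_flipSign (t : Fin n) (ω : SignSpace.{u} n) :
    truncate t (flipSign t ω) = truncate t ω := by
  ext i
  simp only [truncate]
  split_ifs with h
  · rw [flipSign_apply_of_ne]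
    exact fun h' => by simp [h'] at h
  · rfl

theorem past_truncate {t : Fin n} {s : ℕ} (hs : t.1 ≤ s) (ω : SignSpace.{u} n) :
    past (truncate s ω) t = past ω.down t := by
  ext i
  have : i.1 < s := lt_of_lt_of_le i.2 hs
  simp [past, truncate, this]

theorem integral_uniformSigns (φ : SignSpace.{u} n → ℝ) :
    @integral (SignSpace.{u} n) ℝ _ _ ⊤ (uniformSigns n) φ =
      ((2 : ℝ) ^ n)⁻¹ * ∑ ω, φ ω := by
  let _ : MeasurableSpace (SignSpace.{u} n) := ⊤
  have : MeasurableSingletonClass (SignSpace.{u} n) := ⟨fun _ => trivial⟩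
  rw [uniformSigns, PMF.integral_eq_sum, Finset.mul_sum]
  refine Finset.sum_congr rfl fun ω _ => ?_
  simp [Fintype.card_ulift]

instance isProbabilityMeasure_uniformSigns :
    @IsProbabilityMeasure (SignSpace.{u} n) ⊤ (uniformSigns n) :=
  letI : MeasurableSpace (SignSpace.{u} n) := ⊤
  PMF.toMeasure.isProbabilityMeasure _

/-- Flipping the sign at `t` preserves the uniform law and every event of the past. Averaging `φ`
with its flip therefore leaves integrals over such events unchanged, and by hypothesis the average
depends only on the past. -/
theorem condExp_signFiltration (t : Fin n) (φ : SignSpace.{u} n → ℝ) (α : (Fin n → Bool) → ℝ)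
    (h : ∀ ω, φ ω + φ (flipSign t ω) = 2 * α (truncate t ω)) :
    (fun ω => α (truncate t ω)) =ᵐ[uniformSigns n]
      @condExp (SignSpace.{u} n) ℝ (signFiltration n t) ⊤ _ _ (uniformSigns n) φ := by
  let m₀ : MeasurableSpace (SignSpace.{u} n) := ⊤
  have hintegrable : ∀ φ : SignSpace.{u} n → ℝ, Integrable φ (uniformSigns n) := fun φ =>
    have : MeasurableSingletonClass (SignSpace.{u} n) := ⟨fun _ => trivial⟩
    Integrable.of_finite
  refine ae_eq_condExp_of_forall_setIntegral_eq (m₀ := m₀) (le_top) (hintegrable _)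
    (fun s _ _ => (hintegrable _).integrableOn) ?_ ?_
  · rintro s ⟨B, -, rfl⟩ -
    rw [← integral_indicator (by trivial), ← integral_indicator (by trivial),
      integral_uniformSigns, integral_uniformSigns]
    congr 1
    set s := truncate t ⁻¹' B with hs
    have h1 : ∑ ω, s.indicator φ ω = ∑ ω, s.indicator (fun ω => φ (flipSign t ω)) ω := by
      rw [← Equiv.sum_comp (flipSign t)]
      refine Finset.sum_congr rfl fun ω _ => ?_
      have hmem : flipSign t ω ∈ s ↔ ω ∈ s := by
        simp only [hs, Set.mem_preimage, truncate_flipSign]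
      by_cases hω : ω ∈ s
      · rw [Set.indicator_of_mem (hmem.2 hω), Set.indicator_of_mem hω]
      · rw [Set.indicator_of_notMem (mt hmem.1 hω), Set.indicator_of_notMem hω]
    have h2 : ∑ ω, s.indicator φ ω + ∑ ω, s.indicator (fun ω => φ (flipSign t ω)) ω =
        2 * ∑ ω, s.indicator (fun ω => α (truncate t ω)) ω := by
      rw [← Finset.sum_add_distrib, Finset.mul_sum]
      refine Finset.sum_congr rfl fun ω _ => ?_
      simp only [Set.indicator]
      split_ifs
      · exact h ω
      · simp
    linarith
  · refine (Measurable.stronglyMeasurable ?_).aestronglyMeasurable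
    exact (measurable_from_top (f := α)).comp (comap_measurable (truncate t))

theorem sum_sgn_mul_sgn {s t : Fin n} (h : s ≠ t) :
    ∑ ω : SignSpace.{u} n, sgn (ω.down t) * sgn (ω.down s) = 0 := by
  have h1 := Equiv.sum_comp (flipSign.{u} t) fun ω => sgn (ω.down t) * sgn (ω.down s)
  have h2 : ∀ b, sgn (!b) = -sgn b := fun b => by cases b <;> simp [sgn]
  simp only [flipSign_apply_self, flipSign_apply_of_ne h, h2, neg_mul, Finset.sum_neg_distrib] at h1
  linarith

end SignSpace

/-! ### A tree walk violating the martingale law -/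

section UMLLNLower

universe u

variable {X : Type u} {F : Set (X → Bool)}

/-- The process that moves to the current node of the tree if the next sign is positive, and
visits the root otherwise. -/
def treeWalk {n : ℕ} (hn : 1 ≤ n) (x : Tree X n) (t : ℕ) (ω : Fin n → Bool) : X :=
  if ht : t < n then
    if ω ⟨t, ht⟩ then x ⟨t, ht⟩ (past ω ⟨t, ht⟩) else x ⟨0, hn⟩ Fin.elim0
  else x ⟨0, hn⟩ Fin.elim0

/-- The current node alone would be predictable, with zero deviation, so the new sign chooses
between node and root. The compensator is then the average of the values at node and root, and the
function realizing the actual path deviates in a consistent direction. -/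
theorem le_martingaleDeviation {n : ℕ} (hn : 1 ≤ n) (x : Tree X n)
    (f : (Fin n → Bool) → X → Bool) (hf : ∀ ε t, f ε (x t (past ε t)) = ε t) :
    ((n : ℝ) - 1) / (2 * n) ≤ @martingaleDeviation X (Set.range f) n (SignSpace.{u} n) ⊤
      (uniformSigns n) (signFiltration n) (fun t ω => treeWalk hn x t ω.down) := by
  let m₀ : MeasurableSpace (SignSpace.{u} n) := ⊤
  have hintegrable : ∀ φ : SignSpace.{u} n → ℝ, Integrable φ (uniformSigns n) := fun φ =>
    have : MeasurableSingletonClass (SignSpace.{u} n) := ⟨fun _ => trivial⟩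
    Integrable.of_finite
  have hn0 : (0 : ℝ) < n := by exact_mod_cast hn
  set x₀ : X := x ⟨0, hn⟩ Fin.elim0 with hx₀
  have hcond : ∀ᵐ ω ∂(uniformSigns.{u} n), ∀ (ε : Fin n → Bool) (t : Fin n),
      ((uniformSigns n)[fun ω' => sgn (f ε (treeWalk hn x t ω'.down)) |
        signFiltration n t]) ω = (sgn (f ε (x t (past ω.down t))) + sgn (f ε x₀)) / 2 := by
    refine ae_all_iff.2 fun ε => ae_all_iff.2 fun t => ?_
    have h := condExp_signFiltration t (fun ω => sgn (f ε (treeWalk hn x t ω.down)))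
      (fun η => (sgn (f ε (x t (past η t))) + sgn (f ε x₀)) / 2) (fun ω => by
        have h1 := flipSign_apply_self t ω
        have h2 : past (flipSign t ω).down t = past ω.down t := by
          rw [← past_truncate le_rfl, truncate_flipSign, past_truncate le_rfl]
        simp only [treeWalk, t.2, dif_pos, Fin.eta, h1, h2, past_truncate le_rfl]
        cases ω.down t <;> simp [hx₀] <;> ring)
    filter_upwards [h] with ω hω
    rw [← hω, past_truncate le_rfl]
  have hdom : ∀ᵐ ω ∂(uniformSigns.{u} n),
      -- The first sign is the value at the root of the function chosen for `ω`. A positive sign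
      -- gives `1` minus the compensator and a negative one gives the root value minus it; both
      -- equal this expression. Its mean is one half, except at time zero, where it vanishes.
      1 / (n : ℝ) * ∑ t, (1 - sgn (ω.down t) * sgn (ω.down ⟨0, hn⟩)) / 2 ≤
      ⨆ g : Set.range f, |(1 / (n : ℝ)) * ∑ t ∈ Finset.range n,
        (sgn (g.1 (treeWalk hn x t ω.down)) -
          ((uniformSigns n)[fun ω' => sgn (g.1 (treeWalk hn x t ω'.down)) |
            signFiltration n t]) ω)| := by
    filter_upwards [hcond] with ω hω
    refine le_trans ?_ (le_ciSup (Set.finite_range _).bddAbove ⟨f ω.down, ω.down, rfl⟩)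
    refine le_trans (le_of_eq ?_) (le_abs_self _)
    rw [Finset.sum_range]
    congr 1
    refine Finset.sum_congr rfl fun t _ => ?_
    rw [hω]
    have h0 : f ω.down x₀ = ω.down ⟨0, hn⟩ := by
      rw [← hf ω.down ⟨0, hn⟩, hx₀]
      congr 2
      exact Subsingleton.elim _ _
    simp only [treeWalk, t.2, dif_pos, Fin.eta, ← hx₀]
    have ht := hf ω.down t
    cases hb : ω.down t <;> cases hc : ω.down ⟨0, hn⟩ <;> rw [hb] at ht <;>
      norm_num [ht, h0, hc, sgn]
  refine le_trans (le_of_eq ?_) (integral_mono_ae (hintegrable _) (hintegrable _) hdom)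
  rw [integral_const_mul, integral_uniformSigns, Finset.sum_comm]
  have hsum : ∀ t : Fin n, ∑ ω : SignSpace.{u} n,
      (1 - sgn (ω.down t) * sgn (ω.down ⟨0, hn⟩)) / 2 = if t = ⟨0, hn⟩ then 0 else 2 ^ n / 2 := by
    intro t
    rw [← Finset.sum_div, Finset.sum_sub_distrib]
    split_ifs with h
    · have hone : ∀ b : Bool, sgn b * sgn b = 1 := fun b => by cases b <;> simp [sgn]
      simp [h, hone]
    · rw [sum_sgn_mul_sgn (Ne.symm h)]
      simp [Fintype.card_ulift]
  simp only [hsum]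
  rw [Finset.sum_ite, Finset.sum_const_zero, zero_add, Finset.sum_const, Finset.filter_not,
    Finset.card_sdiff_of_subset (Finset.filter_subset _ _)]
  simp only [Finset.filter_eq', Finset.mem_univ, if_true, Finset.card_singleton, Finset.card_univ,
    Fintype.card_fin, nsmul_eq_mul]
  rw [Nat.cast_sub hn]
  field_simp
  simp

variable [MeasurableSpace X]

/-- The walk factors through the first `t + 1` signs, a discrete space, so any σ-algebra on `X` is
allowed. -/
theorem measurable_treeWalk {n : ℕ} (hn : 1 ≤ n) (x : Tree X n) (t : ℕ) :
    Measurable[signFiltration.{u} n (t + 1)] fun ω => treeWalk hn x t ω.down := by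
  have h : (fun ω : SignSpace.{u} n => treeWalk hn x t ω.down) =
      (treeWalk hn x t) ∘ truncate (t + 1) := by
    ext ω
    simp only [treeWalk, Function.comp_apply]
    split_ifs with ht h1 h2 h2
    · rw [past_truncate (t := ⟨t, ht⟩) (Nat.le_succ t)]
    · simp [truncate, h1] at h2
    · simp [truncate, h1] at h2
    · rfl
    · rfl
  rw [h]
  exact (measurable_from_top (f := treeWalk hn x t)).comp (comap_measurable _)

theorem ldim_of_umlln (h : UMLLN F) : ldim F < ⊤ := by
  have hbound : ∀ n, BddAbove {a : ℝ | ∃ (Ω : Type u) (mΩ : MeasurableSpace Ω) (μ : Measure Ω)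
      (𝒜 : Filtration ℕ mΩ) (ξ : ℕ → Ω → X) (G : Set (X → Bool)),
      IsProbabilityMeasure μ ∧ (∀ t, Measurable[𝒜 (t + 1)] (ξ t)) ∧
      G ⊆ F ∧ G.Countable ∧ G.Nonempty ∧ a = martingaleDeviation G n μ 𝒜 ξ} := fun n => by
    refine ⟨2, ?_⟩
    rintro _ ⟨Ω, mΩ, μ, 𝒜, ξ, G, hμ, hξ, hGF, hG, hne, rfl⟩
    exact martingaleDeviation_le_two hG n
  by_contra hcon
  refine limsup_ne_zero_of_eventually (c := 1 / 4) (C := 2) (by norm_num)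
    (Eventually.of_forall fun n => Real.sSup_le ?_ zero_le_two) ?_ h
  · rintro _ ⟨Ω, mΩ, μ, 𝒜, ξ, G, hμ, hξ, hGF, hG, hne, rfl⟩
    exact martingaleDeviation_le_two hG n
  · filter_upwards [eventually_ge_atTop 2] with n hn
    have hn1 : 1 ≤ n := by omega
    obtain ⟨x, hx⟩ := exists_shatters_of_not_lt_top hcon n
    choose f hfF hf using hx
    have h1 := le_martingaleDeviation hn1 x f hf
    have h2 : (1 : ℝ) / 4 ≤ ((n : ℝ) - 1) / (2 * n) := by
      have : (2 : ℝ) ≤ n := by exact_mod_cast hn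
      rw [div_le_div_iff₀ (by norm_num) (by positivity)]
      linarith
    refine (h2.trans h1).trans (le_csSup (hbound n) ⟨SignSpace.{u} n, ⊤, uniformSigns n,
      signFiltration n, _, Set.range f, isProbabilityMeasure_uniformSigns,
      measurable_treeWalk hn1 x, ?_, Set.countable_range f, Set.range_nonempty f, rfl⟩)
    rintro _ ⟨ε, rfl⟩
    exact hfF ε

end UMLLNLower

end

end Learn

/-! ### The equivalence, with finite Littlestone dimension as the hub -/

theorem mainTheorem2 {X : Type*} [MeasurableSpace X] (F : Set (X → Bool)) (hF : F.Nonempty)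
    (hmeas : ∀ f ∈ F, Measurable f) :
    List.TFAE [
      Learn.OnlineLearnable F,
      Learn.UMLLN F,
      Learn.ldim F < ⊤,
      limsup (fun n : ℕ => Learn.seqRad F n) atTop = 0,
      Learn.PrequentiallyLearnable F] := by
  tfae_have 3 → 1 := Learn.onlineLearnable_of_ldim hF
  tfae_have 1 → 3 := Learn.ldim_of_onlineLearnable hF
  tfae_have 3 → 2 := Learn.umlln_of_ldim hmeas
  tfae_have 2 → 3 := Learn.ldim_of_umlln
  tfae_have 3 → 4 := Learn.limsup_seqRad_of_ldim hF
  tfae_have 4 → 3 := Learn.ldim_of_limsup_seqRad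
  tfae_have 3 → 5 := Learn.prequentiallyLearnable_of_ldim hF hmeas
  tfae_have 5 → 3 := Learn.ldim_of_prequentiallyLearnable hF hmeas
  tfae_finish
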